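/- Let $n\ge 1$, $\mathbb T=\mathbb R/\mathbb Z$, and let $k_1,k_2\in\mathbb R$ satisfy $\frac{-k_1}{\pi}e^{\frac{4\pi}{n+1}k_2}>n+1$. Put $\rho_2=\sqrt{\frac{n+1}{4\pi^2}\log\left(\frac{-k_1}{\pi}\right)+\frac{k_2}{\pi}}$. Let $v_0,\dots,v_n\in\mathbb Z^n$ be the vertices $(n+1)e_i-(1,\dots,1)$ (one for each of the $n$ standard basis vectors $e_i$) and $-(1,\dots,1)$ of the polytope $\Delta_n$ of $\mathbb{CP}^n$, and let $u_0,\dots,u_n$ be the corresponding vertices $e_i$ and $-(1,\dots,1)$ of the dual polytope $\Delta_n^*$. Let $f_{\Delta_n},f_{\Delta_n^*}:\mathbb T^{n+1}\to\mathbb T^n$ be the homomorphisms $x\mapsto\sum_i x_iu_i$ and $x\mapsto\sum_i x_iv_i$, let $f_{\Delta_n}^*,f_{\Delta_n^*}^*:\mathbb T^n\to\mathbb T^{n+1}$ be given by the transposed matrices, and put $N_{\Delta_n}=\ker f_{\Delta_n}$, $N_{\Delta_n^*}=\ker f_{\Delta_n^*}$, $D_{\Delta_n}=N_{\Delta_n}\cap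 \mathrm{Im} f_{\Delta_n^*}^*$, $D_{\Delta_n^*}=N_{\Delta_n^*}\cap \mathrm{Im} f_{\Delta_n}^*$. On the space $P$ of all $(\theta,r,\eta)\in\mathbb T^{n+1}\times\mathbb R_{>0}^{n+1}\times\mathbb T^{n+1}$ consider the form $\tilde\omega_2=\frac1{2\pi}\sum_{i=0}^n\frac1{r_i}\,dr_i\wedge d\eta_i$. Let $$\tilde{\mathbb X}=\Big\{(\theta,r,\eta)\in P : \theta\in \mathrm{Im} f^*_{\Delta_n^*},\ \eta\in \mathrm{Im} f^*_{\Delta_n},\ -\pi\sum_i r_i^2=k_1,\ -\tfrac1{2\pi}\log\prod_i r_i=k_2\Big\},$$ and let $\mathbb X^{n-1}_{k_1,k_2}=\tilde{\mathbb X}/(D_{\Delta_n}\times D_{\Delta_n^*})$, the quotient by translations of $(\theta,\eta)$, with the form $\omega_2$ induced by $\tilde\omega_2$. Let $\omega_2^0$ denote the distribution on $\mathbb X^{n-1}_{k_1,k_2}$ induced by the null distribution of $\tilde\omega_2$ on $P$, i.e. the vectors tangent to $\tilde{\mathbb X}$ which $\tilde\omega_2$ pairs to zero with all vectors tangent to $P$.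 The torus $\mathbb T^n\times\mathbb T^n$ acts on $\mathbb X^{n-1}_{k_1,k_2}$: lift $(t_1,t_2)$ along $f_{\Delta_n}\times f_{\Delta_n^*}$ to an element of $\mathrm{Im} f^*_{\Delta_n^*}\times \mathrm{Im} f^*_{\Delta_n}$ and translate $(\theta,\eta)$ by it. Let $H^n=\mathbb{CP}^n/N_{\Delta_n^*}$, where $s\in\mathbb T^{n+1}$ acts by $[z_j]\mapsto[e^{2\pi i s_j}z_j]$. (This is the toric variety of $\Delta_n^*$; the diagonal of $\mathbb T^{n+1}$ is contained in $N_{\Delta_n^*}$ and acts trivially, so the acting group is the finite group $N_{\Delta_n^*}/\mathbb T$.) The torus $\mathbb T^n$ acts on $H^n$ by lifting along $f_{\Delta_n^*}$ and acting diagonally. Let $\omega_{FS}$ be the K\"ahler form on $H^n$ induced by the Fubini-Study form $\frac i2\partial\bar\partial\log|z|^2$ of $\mathbb{CP}^n$. Smoothness, differentials and pull-backs of forms for maps into the orbifold $H^n$ are understood through smooth local lifts to homogeneous coordinates of $\mathbb{CP}^n$. Then there is a smooth map $\pi_2:\mathbb X^{n-1}_{k_1,k_2}\to H^n$ such that: 1.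 the non-empty fibres of $\pi_2$ are exactly the leaves of $\omega_2^0$, and the kernel of $d\pi_2$ is $\omega_2^0$ at every point; 2. $\pi_2$ is equivariant with respect to the homomorphism $\mathbb T^n\times\mathbb T^n\to\mathbb T^n$, $(t_1,t_2)\mapsto -t_2$ (the second projection followed by inversion); 3. $\rho_2>0$ and $\omega_2=\pi_2^*(\rho_2^2\,\omega_{FS})$; 4. in homogeneous coordinates of the covering $\mathbb{CP}^n$ normalized by $\sum_{i=0}^n|z_i|^2=\rho_2^2$, the image of $\pi_2$ is the set of the points $[z_0,\dots,z_n]\in H^n$ which satisfy $\sum_{i=0}^n e^{-4\pi^2|z_i|^2}=1$. -/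

import Mathlib

open scoped ContDiff LinearAlgebra.Projectivization

/-- The real torus `𝕋^m = (ℝ/ℤ)^m`. -/
abbrev Torus (m : ℕ) : Type := Fin m → UnitAddCircle

/-! ### The polytopes and the associated homomorphisms of tori -/

/-- The vertices of the polytope of `ℂℙ^n`: `(n+1) e_i - (1,…,1)` for `i < n`, and `-(1,…,1)`. -/
def vertexDelta (n : ℕ) (i : Fin (n + 1)) (k : Fin n) : ℤ :=
  if i = k.castSucc then n else -1

/-- The vertices of the dual polytope: `e_i` for `i < n`, and `-(1,…,1)`. -/
def vertexDual (n : ℕ) (i : Fin (n + 1)) (k : Fin n) : ℤ :=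
  if i = k.castSucc then 1 else if i = Fin.last n then -1 else 0

/-- The homomorphism `𝕋^{n+1} → 𝕋^n` induced by the linear map `x ↦ ∑ x_i w_i`. -/
def torusHom {n : ℕ} (w : Fin (n + 1) → Fin n → ℤ) : Torus (n + 1) →+ Torus n where
  toFun x := fun k => ∑ i, w i k • x i
  map_zero' := by ext; simp
  map_add' x y := by ext k; simp [smul_add, Finset.sum_add_distrib]

/-- The homomorphism `𝕋^n → 𝕋^{n+1}` induced by the transposed matrix. -/
def torusHomT {n : ℕ} (w : Fin (n + 1) → Fin n → ℤ) : Torus n →+ Torus (n + 1) where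
  toFun y := fun i => ∑ k, w i k • y k
  map_zero' := by ext; simp
  map_add' x y := by ext k; simp [smul_add, Finset.sum_add_distrib]

/-- The real linear map `ℝ^n → ℝ^{n+1}` given by the transposed matrix. -/
def realHomT {n : ℕ} (w : Fin (n + 1) → Fin n → ℤ) : (Fin n → ℝ) →ₗ[ℝ] (Fin (n + 1) → ℝ) where
  toFun y := fun i => ∑ k, (w i k : ℝ) * y k
  map_add' x y := by ext k; simp [mul_add, Finset.sum_add_distrib]
  map_smul' c x := by ext k; simp [Finset.mul_sum, mul_left_comm]

/-- `f_Δ` is built from the vertices of the dual polytope. -/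
def fDelta (n : ℕ) : Torus (n + 1) →+ Torus n := torusHom (vertexDual n)

/-- `f_{Δ*}` is built from the vertices of the polytope. -/
def fDual (n : ℕ) : Torus (n + 1) →+ Torus n := torusHom (vertexDelta n)

/-- `f_Δ^*`. -/
def fDeltaT (n : ℕ) : Torus n →+ Torus (n + 1) := torusHomT (vertexDual n)

/-- `f_{Δ*}^*`. -/
def fDualT (n : ℕ) : Torus n →+ Torus (n + 1) := torusHomT (vertexDelta n)

/-- `N_Δ = ker f_Δ`. -/
def NDelta (n : ℕ) : AddSubgroup (Torus (n + 1)) := (fDelta n).ker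

/-- `N_{Δ*} = ker f_{Δ*}`. -/
def NDual (n : ℕ) : AddSubgroup (Torus (n + 1)) := (fDual n).ker

/-- `D_Δ = N_Δ ∩ Im f_{Δ*}^*`. -/
def DDelta (n : ℕ) : AddSubgroup (Torus (n + 1)) := NDelta n ⊓ (fDualT n).range

/-- `D_{Δ*} = N_{Δ*} ∩ Im f_Δ^*`. -/
def DDual (n : ℕ) : AddSubgroup (Torus (n + 1)) := NDual n ⊓ (fDeltaT n).range

theorem vertexDelta_eq (n : ℕ) (i : Fin (n + 1)) (k : Fin n) :
    vertexDelta n i k = (if i = k.castSucc then ((n + 1 : ℕ) : ℤ) else 0) - 1 := by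
  unfold vertexDelta
  split_ifs <;> simp

theorem vertexDual_eq (n : ℕ) (i : Fin (n + 1)) (k : Fin n) :
    vertexDual n i k = (if i = k.castSucc then 1 else 0) - (if i = Fin.last n then 1 else 0) := by
  unfold vertexDual
  by_cases h : i = k.castSucc
  · have : i ≠ Fin.last n := by rw [h]; exact (Fin.castSucc_lt_last k).ne
    simp [h]
  · split_ifs <;> simp

theorem fDelta_fDualT (n : ℕ) (y : Torus n) : fDelta n (fDualT n y) = (n + 1) • y := by
  ext k
  simp only [fDelta, fDualT, torusHom, torusHomT, AddMonoidHom.coe_mk, ZeroHom.coe_mk,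
    vertexDual_eq, vertexDelta_eq, sub_smul, ite_smul, one_smul, zero_smul, natCast_zsmul,
    Finset.sum_sub_distrib, Finset.sum_ite_eq', Finset.mem_univ, if_true, Pi.smul_apply,
    Fin.castSucc_inj, Finset.sum_ite_eq, (Fin.castSucc_lt_last _).ne', if_false,
    Finset.sum_const_zero]
  abel

theorem fDual_fDeltaT (n : ℕ) (y : Torus n) : fDual n (fDeltaT n y) = (n + 1) • y := by
  ext k
  have h : ∑ i, fDeltaT n y i = 0 := by
    simp only [fDeltaT, torusHomT, AddMonoidHom.coe_mk, ZeroHom.coe_mk]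
    rw [Finset.sum_comm]
    simp [vertexDual_eq, sub_smul, ite_smul, Finset.sum_sub_distrib]
  have h' : fDeltaT n y k.castSucc = y k := by
    simp [fDeltaT, torusHomT, vertexDual_eq, sub_smul, ite_smul, Finset.sum_sub_distrib,
      (Fin.castSucc_lt_last _).ne]
  have h'' : fDual n (fDeltaT n y) k
      = (n + 1) • fDeltaT n y k.castSucc - ∑ i, fDeltaT n y i := by
    simp only [fDual, torusHom, AddMonoidHom.coe_mk, ZeroHom.coe_mk, vertexDelta_eq, sub_smul,
      ite_smul, one_smul, zero_smul, natCast_zsmul, Finset.sum_sub_distrib, Finset.sum_ite_eq',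
      Finset.mem_univ, if_true]
  rw [h'', h, h', sub_zero, Pi.smul_apply]

theorem torus_divisible (n : ℕ) (t : Torus n) : ∃ y : Torus n, (n + 1) • y = t := by
  have h : ∀ a : UnitAddCircle, ∃ b : UnitAddCircle, (n + 1) • b = a := by
    intro a
    refine ⟨DivisibleBy.div a ((n : ℤ) + 1), ?_⟩
    have := DivisibleBy.div_cancel (A := UnitAddCircle) (α := ℤ) (n := (n : ℤ) + 1) a (by omega)
    rw [← this]
    simp only [this]
    conv_rhs => rw [← this]
    rw [← natCast_zsmul]
    push_cast
    rfl
  choose g hg using h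
  exact ⟨fun i => g (t i), by ext i; exact hg (t i)⟩

theorem exists_lift_delta (n : ℕ) (t : Torus n) : ∃ s ∈ (fDualT n).range, fDelta n s = t := by
  obtain ⟨y, hy⟩ := torus_divisible n t
  exact ⟨fDualT n y, ⟨y, rfl⟩, by rw [fDelta_fDualT, hy]⟩

theorem exists_lift_dual (n : ℕ) (t : Torus n) : ∃ s ∈ (fDeltaT n).range, fDual n s = t := by
  obtain ⟨y, hy⟩ := torus_divisible n t
  exact ⟨fDeltaT n y, ⟨y, rfl⟩, by rw [fDual_fDeltaT, hy]⟩

/-- A lift of `t ∈ 𝕋^n` along `f_Δ` lying in `Im f_{Δ*}^*`, unique up to `D_Δ`. -/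
noncomputable def liftDelta (n : ℕ) (t : Torus n) : Torus (n + 1) :=
  (exists_lift_delta n t).choose

/-- A lift of `t ∈ 𝕋^n` along `f_{Δ*}` lying in `Im f_Δ^*`, unique up to `D_{Δ*}`. -/
noncomputable def liftDual (n : ℕ) (t : Torus n) : Torus (n + 1) :=
  (exists_lift_dual n t).choose

theorem liftDelta_mem (n : ℕ) (t : Torus n) : liftDelta n t ∈ (fDualT n).range :=
  (exists_lift_delta n t).choose_spec.1

theorem fDelta_liftDelta (n : ℕ) (t : Torus n) : fDelta n (liftDelta n t) = t :=
  (exists_lift_delta n t).choose_spec.2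

theorem liftDual_mem (n : ℕ) (t : Torus n) : liftDual n t ∈ (fDeltaT n).range :=
  (exists_lift_dual n t).choose_spec.1

theorem fDual_liftDual (n : ℕ) (t : Torus n) : fDual n (liftDual n t) = t :=
  (exists_lift_dual n t).choose_spec.2

/-! ### The manifold `𝕏^{n-1}_{k₁,k₂}` -/

/-- The fibred product `(ℂ^*)^{n+1} ×_μ (ℂ^*)^{n+1}`, i.e. the pairs `(z, w)` with `|z_i| = |w_i|`,
in its global coordinates `(θ, r, η)`: `z_i = r_i e^{2π i θ_i}`, `w_i = r_i e^{2π i η_i}`.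
The condition `r_i > 0` is imposed where the points are used. -/
abbrev Ambient (n : ℕ) : Type := Torus (n + 1) × (Fin (n + 1) → ℝ) × Torus (n + 1)

/-- `μ₁ = -π ∑ r_i²`. -/
noncomputable def mu1 {n : ℕ} (r : Fin (n + 1) → ℝ) : ℝ := -(Real.pi * ∑ i, r i ^ 2)

/-- `μ₂ = -(1/2π) log ∏ r_i`. -/
noncomputable def mu2 {n : ℕ} (r : Fin (n + 1) → ℝ) : ℝ :=
  -(1 / (2 * Real.pi) * Real.log (∏ i, r i))

/-- The submanifold `𝕏̃^{n-1}_{k₁,k₂}` of the fibred product. -/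
def Xtilde (n : ℕ) (k₁ k₂ : ℝ) : Set (Ambient n) :=
  {p | (∀ i, 0 < p.2.1 i) ∧ p.1 ∈ (fDualT n).range ∧ p.2.2 ∈ (fDeltaT n).range ∧
    mu1 p.2.1 = k₁ ∧ mu2 p.2.1 = k₂}

/-- Two points of `𝕏̃` are identified when they differ by an element of `D_Δ × D_{Δ*}`. -/
def Xsetoid (n : ℕ) (k₁ k₂ : ℝ) : Setoid (Xtilde n k₁ k₂) where
  r p q := q.1.1 - p.1.1 ∈ DDelta n ∧ q.1.2.1 = p.1.2.1 ∧ q.1.2.2 - p.1.2.2 ∈ DDual n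
  iseqv :=
    { refl := fun p => by simp [zero_mem]
      symm := fun {p q} h => by
        refine ⟨?_, h.2.1.symm, ?_⟩
        · rw [← neg_sub]; exact neg_mem h.1
        · rw [← neg_sub]; exact neg_mem h.2.2
      trans := fun {p q s} h h' => by
        refine ⟨?_, h'.2.1.trans h.2.1, ?_⟩
        · rw [← sub_add_sub_cancel]; exact add_mem h'.1 h.1
        · rw [← sub_add_sub_cancel]; exact add_mem h'.2.2 h.2.2 }

/-- `𝕏^{n-1}_{k₁,k₂} = 𝕏̃^{n-1}_{k₁,k₂} / (D_Δ × D_{Δ*})`. -/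
def XSpace (n : ℕ) (k₁ k₂ : ℝ) : Type := Quotient (Xsetoid n k₁ k₂)

/-- Translation of `𝕏̃` by a pair of elements of `Im f_{Δ*}^* × Im f_Δ^*`. -/
def Xtranslate {n : ℕ} {k₁ k₂ : ℝ} (a : (fDualT n).range) (b : (fDeltaT n).range)
    (p : Xtilde n k₁ k₂) : Xtilde n k₁ k₂ :=
  ⟨(a.1 + p.1.1, p.1.2.1, b.1 + p.1.2.2),
    p.2.1, add_mem a.2 p.2.2.1, add_mem b.2 p.2.2.2.1, p.2.2.2.2⟩

/-- The natural action of `𝕋^n × 𝕋^n` on `𝕏`: lift `(t₁, t₂)` along `f_Δ × f_{Δ*}` to a pair that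
preserves `𝕏̃`, and translate `(θ, η)` by it. -/
noncomputable instance XSpace.instAddAction (n : ℕ) (k₁ k₂ : ℝ) :
    AddAction (Torus n × Torus n) (XSpace n k₁ k₂) where
  vadd t := Quotient.map
    (Xtranslate ⟨liftDelta n t.1, liftDelta_mem n t.1⟩ ⟨liftDual n t.2, liftDual_mem n t.2⟩)
    (fun p q h => ⟨by simpa [Xtranslate] using h.1, h.2.1, by simpa [Xtranslate] using h.2.2⟩)
  zero_vadd p := by
    induction p using Quotient.inductionOn with
    | _ p =>
      refine Quotient.sound (s := Xsetoid n k₁ k₂) ((Xsetoid n k₁ k₂).symm ⟨?_, rfl, ?_⟩)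
      · simp only [Xtranslate, add_sub_cancel_right]
        exact ⟨fDelta_liftDelta n _, liftDelta_mem n _⟩
      · simp only [Xtranslate, add_sub_cancel_right]
        exact ⟨fDual_liftDual n _, liftDual_mem n _⟩
  add_vadd s t p := by
    induction p using Quotient.inductionOn with
    | _ p =>
      refine Quotient.sound (s := Xsetoid n k₁ k₂) ((Xsetoid n k₁ k₂).symm ⟨?_, rfl, ?_⟩)
      · simp only [Xtranslate, ← add_assoc, add_sub_add_right_eq_sub]
        refine AddSubgroup.mem_inf.2 ⟨?_,
          sub_mem (liftDelta_mem n _) (add_mem (liftDelta_mem n _) (liftDelta_mem n _))⟩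
        simp [NDelta, fDelta_liftDelta]
      · simp only [Xtranslate, ← add_assoc, add_sub_add_right_eq_sub]
        refine AddSubgroup.mem_inf.2 ⟨?_,
          sub_mem (liftDual_mem n _) (add_mem (liftDual_mem n _) (liftDual_mem n _))⟩
        simp [NDual, fDual_liftDual]

/-! ### Local coordinates, tangent spaces and forms

`(θ, r, η) ∈ ℝ^{n+1} × ℝ^{n+1} × ℝ^{n+1}`, with the angles read modulo `1`, are local coordinates of
the fibred product.  Since `𝕏̃ → 𝕏` is the quotient by a free action of a finite group, objects
on `𝕏` are described locally on the preimage of `𝕏̃` in this coordinate space. -/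

/-- The coordinate space, with points (and tangent vectors) `(θ, r, η)`. -/
abbrev Coord (n : ℕ) : Type := (Fin (n + 1) → ℝ) × (Fin (n + 1) → ℝ) × (Fin (n + 1) → ℝ)

/-- The covering of the fibred product by the coordinate space. -/
def coordMap {n : ℕ} (x : Coord n) : Ambient n :=
  (fun i => (x.1 i : UnitAddCircle), x.2.1, fun i => (x.2.2 i : UnitAddCircle))

/-- The point of `𝕏` with given coordinates. -/
def toX {n : ℕ} {k₁ k₂ : ℝ} (x : Coord n) (hx : coordMap x ∈ Xtilde n k₁ k₂) : XSpace n k₁ k₂ :=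
  Quotient.mk (Xsetoid n k₁ k₂) ⟨coordMap x, hx⟩

/-- The tangent space of `𝕏` (equivalently of `𝕏̃`) at the point with coordinates `x`:
`(Im F_{Δ*}^* × ℝ^{n+1} × Im F_Δ^*) ∩ ker dμ₁ ∩ ker dμ₂`. -/
def tangentX {n : ℕ} (x : Coord n) : Set (Coord n) :=
  {u | u.1 ∈ LinearMap.range (realHomT (vertexDelta n)) ∧
    u.2.2 ∈ LinearMap.range (realHomT (vertexDual n)) ∧
    fderiv ℝ mu1 x.2.1 u.2.1 = 0 ∧ fderiv ℝ mu2 x.2.1 u.2.1 = 0}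

/-- The `2`-form `ω̃₂ = (1/2π) ∑ (1/r_i) dr_i ∧ dη_i` on the fibred product; its restriction to the
tangent spaces of `𝕏` is `ω₂`. -/
noncomputable def omegaTilde2 {n : ℕ} (x u v : Coord n) : ℝ :=
  1 / (2 * Real.pi) * ∑ i, 1 / x.2.1 i * (u.2.1 i * v.2.2 i - u.2.2 i * v.2.1 i)

/-- The distribution `ω₂⁰` on `𝕏`: the restriction to `𝕏` of the null distribution of `ω̃₂`, i.e. the
vectors tangent to `𝕏` that `ω̃₂` pairs to zero with every vector tangent to the fibred product. It is
spanned by the directions in which only `θ` varies. (Pairing with vectors tangent to `𝕏` only would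
leave one more null direction, transverse to the orbits of the first torus factor.) -/
def omega2Null {n : ℕ} (x : Coord n) : Set (Coord n) :=
  {u | u ∈ tangentX x ∧ ∀ w : Coord n, omegaTilde2 x u w = 0}

/-- The leaf through `p` of a distribution on `𝕏`: the points that can be joined to `p` by a smooth
curve tangent to the distribution. Curves in `𝕏` are given by their lifts to the
coordinate space. -/
def leafThrough {n : ℕ} {k₁ k₂ : ℝ} (dist : Coord n → Set (Coord n)) (p : XSpace n k₁ k₂) :
    Set (XSpace n k₁ k₂) :=
  {q | ∃ γ : ℝ → Coord n, ContDiff ℝ ∞ γ ∧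
    (∀ t ∈ Set.Icc (0 : ℝ) 1, coordMap (γ t) ∈ Xtilde n k₁ k₂ ∧ deriv γ t ∈ dist (γ t)) ∧
    (∃ h, toX (γ 0) h = p) ∧ (∃ h, toX (γ 1) h = q)}

/-! ### The space `H^n` -/

/-- The diagonal action of `s ∈ 𝕋^{n+1}` on `ℂ^{n+1}`: `z ↦ (e^{2π i s_j} z_j)_j`. -/
noncomputable def phase {n : ℕ} (s : Torus (n + 1)) :
    (Fin (n + 1) → ℂ) →ₗ[ℂ] (Fin (n + 1) → ℂ) :=
  LinearMap.pi fun i => ((AddCircle.toCircle (s i) : Circle) : ℂ) • LinearMap.proj i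

theorem phase_apply {n : ℕ} (s : Torus (n + 1)) (z : Fin (n + 1) → ℂ) (i : Fin (n + 1)) :
    phase s z i = ((AddCircle.toCircle (s i) : Circle) : ℂ) * z i := rfl

theorem phase_injective {n : ℕ} (s : Torus (n + 1)) : Function.Injective (phase s) := by
  intro z w h
  ext i
  have := congrFun h i
  rw [phase_apply, phase_apply] at this
  exact mul_left_cancel₀ (Circle.coe_ne_zero _) this

theorem phase_zero {n : ℕ} : phase (0 : Torus (n + 1)) = LinearMap.id := by
  refine LinearMap.ext fun z => funext fun i => ?_
  simp [phase_apply]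

theorem phase_add {n : ℕ} (s t : Torus (n + 1)) :
    phase (s + t) = (phase s).comp (phase t) := by
  refine LinearMap.ext fun z => funext fun i => ?_
  simp [phase_apply, AddCircle.toCircle_add, mul_assoc]

/-- The diagonal action of `𝕋^{n+1}` on `ℂℙ^n`. -/
noncomputable def projPhase {n : ℕ} (s : Torus (n + 1)) (p : ℙ ℂ (Fin (n + 1) → ℂ)) :
    ℙ ℂ (Fin (n + 1) → ℂ) :=
  Projectivization.map (phase s) (phase_injective s) p

theorem projPhase_zero {n : ℕ} (p : ℙ ℂ (Fin (n + 1) → ℂ)) :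
    projPhase (0 : Torus (n + 1)) p = p := by
  induction p using Projectivization.ind with
  | h v hv => simp [projPhase, Projectivization.map_mk, phase_zero]

theorem projPhase_add {n : ℕ} (s t : Torus (n + 1)) (p : ℙ ℂ (Fin (n + 1) → ℂ)) :
    projPhase (s + t) p = projPhase s (projPhase t p) := by
  induction p using Projectivization.ind with
  | h v hv => simp [projPhase, Projectivization.map_mk, phase_add]

/-- Points of `ℂℙ^n` are identified when they differ by an element of `N_{Δ*}`. -/
def Hsetoid (n : ℕ) : Setoid (ℙ ℂ (Fin (n + 1) → ℂ)) where
  r p q := ∃ s ∈ NDual n, q = projPhase s p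
  iseqv :=
    { refl := fun p => ⟨0, zero_mem _, (projPhase_zero p).symm⟩
      symm := fun {p q} h => by
        obtain ⟨s, hs, rfl⟩ := h
        exact ⟨-s, neg_mem hs, by rw [← projPhase_add, neg_add_cancel, projPhase_zero]⟩
      trans := fun {p q r} h h' => by
        obtain ⟨s, hs, rfl⟩ := h
        obtain ⟨t, ht, rfl⟩ := h'
        exact ⟨t + s, add_mem ht hs, by rw [projPhase_add]⟩ }

/-- The toric variety `H^n` of the dual polytope: the quotient of `ℂℙ^n` by `N_{Δ*}`, that is, by the
finite group `N_{Δ*}/(diagonal circle)`, since the diagonal acts trivially; equivalently the quotient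
of a sphere in `ℂ^{n+1}` by `N_{Δ*}`. -/
def DualToric (n : ℕ) : Type := Quotient (Hsetoid n)

/-- The point `[z_0, …, z_n]` of `H^n`, in homogeneous coordinates of the covering `ℂℙ^n`. -/
noncomputable def DualToric.mk {n : ℕ} (z : Fin (n + 1) → ℂ) (hz : z ≠ 0) : DualToric n :=
  Quotient.mk (Hsetoid n) (Projectivization.mk ℂ z hz)

/-- The natural action of `𝕋^n` on `H^n`: lift to `𝕋^{n+1}` along `f_{Δ*}` and act diagonally. -/
noncomputable instance DualToric.instAddAction (n : ℕ) : AddAction (Torus n) (DualToric n) where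
  vadd t := Quotient.map (projPhase (liftDual n t)) (fun p q h => by
    obtain ⟨s, hs, rfl⟩ := h
    exact ⟨s, hs, by rw [← projPhase_add, ← projPhase_add, add_comm (liftDual n t) s]⟩)
  zero_vadd p := by
    induction p using Quotient.inductionOn with
    | _ p =>
      exact Quotient.sound (s := Hsetoid n)
        ((Hsetoid n).symm ⟨liftDual n 0, fDual_liftDual n 0, rfl⟩)
  add_vadd s t p := by
    induction p using Quotient.inductionOn with
    | _ p =>
      refine Quotient.sound (s := Hsetoid n) ((Hsetoid n).symm
        ⟨liftDual n (s + t) - (liftDual n s + liftDual n t), ?_, ?_⟩)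
      · simp [NDual, AddMonoidHom.mem_ker, fDual_liftDual]
      · rw [← projPhase_add (liftDual n s), ← projPhase_add, sub_add_cancel]

/-- The Fubini–Study form of `ℂℙ^n` in homogeneous coordinates, `(i/2) ∂∂̄ log |z|²`, evaluated at `z`
on `u, v ∈ ℂ^{n+1}`. On vectors tangent to the unit sphere it is the standard symplectic form
`∑ dx_j ∧ dy_j`; it is invariant under the diagonal torus, hence descends to `H^n`. -/
noncomputable def fubiniStudy {n : ℕ} (z u v : Fin (n + 1) → ℂ) : ℝ :=
  ((∑ i, star (u i) * v i) / (∑ i, star (z i) * z i) -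
    (∑ i, star (u i) * z i) * (∑ i, star (z i) * v i) / (∑ i, star (z i) * z i) ^ 2).im

/-- `F` is, near the point with coordinates `x`, a smooth lift of `f : 𝕏 → H^n` to homogeneous
coordinates of the covering `ℂℙ^n`. -/
def IsLocalLift {n : ℕ} {k₁ k₂ : ℝ} (f : XSpace n k₁ k₂ → DualToric n) (x : Coord n)
    (F : Coord n → Fin (n + 1) → ℂ) : Prop :=
  ∃ U : Set (Coord n), IsOpen U ∧ x ∈ U ∧ ContDiffOn ℝ ∞ F U ∧
    ∀ y ∈ U, ∀ hy : coordMap y ∈ Xtilde n k₁ k₂, ∃ h : F y ≠ 0, f (toX y hy) = DualToric.mk (F y) h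

/-- Smoothness of a map from `𝕏` to the orbifold `H^n`: it has smooth local lifts. -/
def IsSmoothToH {n : ℕ} {k₁ k₂ : ℝ} (f : XSpace n k₁ k₂ → DualToric n) : Prop :=
  ∀ x : Coord n, coordMap x ∈ Xtilde n k₁ k₂ → ∃ F, IsLocalLift f x F

/-- The fibres of `f` are the leaves of the distribution: each (non-empty) fibre is, as a set, the
leaf through any of its points, and the kernel of `df` is the distribution. (A vector is in the kernel of `df` when
the derivative of a lift to homogeneous coordinates takes it to a multiple of the lift.) -/
def FibresAreLeaves {n : ℕ} {k₁ k₂ : ℝ} (f : XSpace n k₁ k₂ → DualToric n)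
    (dist : Coord n → Set (Coord n)) : Prop :=
  (∀ p, f ⁻¹' {f p} = leafThrough dist p) ∧
  ∀ x : Coord n, coordMap x ∈ Xtilde n k₁ k₂ → ∀ F, IsLocalLift f x F →
    ∀ u ∈ tangentX x, (∃ c : ℂ, fderiv ℝ F x u = c • F x) ↔ u ∈ dist x

/-- `ω₂ = f^*(c ω_FS)` on the tangent spaces of `𝕏`. -/
def Omega2IsPullback {n : ℕ} {k₁ k₂ : ℝ} (f : XSpace n k₁ k₂ → DualToric n) (c : ℝ) : Prop :=
  ∀ x : Coord n, coordMap x ∈ Xtilde n k₁ k₂ → ∀ F, IsLocalLift f x F →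
    ∀ u ∈ tangentX x, ∀ v ∈ tangentX x,
      omegaTilde2 x u v = c * fubiniStudy (F x) (fderiv ℝ F x u) (fderiv ℝ F x v)

/-- `ρ₂ = √((n+1)/(4π²) log(-k₁/π) + k₂/π)`. -/
noncomputable def rho2 (n : ℕ) (k₁ k₂ : ℝ) : ℝ :=
  √(((n : ℝ) + 1) / (4 * Real.pi ^ 2) * Real.log (-k₁ / Real.pi) + k₂ / Real.pi)

/-! ### Tori -/

/-! The map is `toricMap`: `(θ, r, η)` goes to the point with `z_i = √h_i · e^{-2πi η_i}`, where
`h_i` is defined by `r_i² = (-k₁/π) e^{-4π² h_i}`. In these terms the level of `μ₁` reads `∑ e^{-4π²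
h_i} = 1` and the level of `μ₂` reads `∑ h_i = ρ₂²`, which gives the image (`range_toricMap`). Since
`dh_i = -dr_i/(2π² r_i)`, the form `∑ dx_i ∧ dy_i = ½ ∑ dh_i ∧ d(-2πη_i)` equals `ω̃₂`, and on the
sphere of radius `ρ₂` it agrees with `ρ₂² ω_FS`. For `n ≥ 1` every `h_i` is positive, so no
coordinate vanishes and the formula is smooth.

Two points have the same image exactly when their `r` agree and their `η` differ by `D_{Δ*}`
(`toricMap_eq_iff`); `θ` is then free in the connected group `Im f_{Δ*}^*`, so the fibres are
leaves.

The assertions on differentials concern every local lift `F`, not only the standard one `g`. On `𝕏̃`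
the two differ by a scalar and an element of `N_{Δ*}`, whose phases have equal `(n+1)`-th powers;
hence `(F_i g_0)^{n+1} = (g_i F_0)^{n+1}` there. Differentiating along curves in `𝕏̃` shows that the
logarithmic derivatives of `F` and `g` differ by a constant independent of `i`
(`IsLocalLift.fderiv_eq`), to which neither the Fubini–Study form nor the kernel condition is
sensitive. Enough such curves exist by the implicit function theorem, as the inequality on `k₁, k₂`
makes `dμ₁` and `dμ₂` independent. -/

theorem fDual_apply (n : ℕ) (s : Torus (n + 1)) (k : Fin n) :
    fDual n s k = (n + 1) • s k.castSucc - ∑ i, s i := by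
  simp only [fDual, torusHom, AddMonoidHom.coe_mk, ZeroHom.coe_mk, vertexDelta_eq, sub_smul,
    ite_smul, one_smul, zero_smul, natCast_zsmul, Finset.sum_sub_distrib, Finset.sum_ite_eq',
    Finset.mem_univ, if_true]

/-- The kernel condition gives only the first `n` equalities; subtracting their sum from `(n+1) ∑
s_j` yields the last one. In this symmetric form it is plain that constants lie in `N_{Δ*}`. -/
theorem mem_NDual_iff {n : ℕ} {s : Torus (n + 1)} :
    s ∈ NDual n ↔ ∀ i, (n + 1) • s i = ∑ j, s j := by
  constructor
  · intro h
    have h1 : ∀ k : Fin n, (n + 1) • s k.castSucc = ∑ j, s j := fun k => by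
      have := congrFun (AddMonoidHom.mem_ker.1 h) k
      rw [fDual_apply] at this
      exact sub_eq_zero.1 this
    intro i
    refine Fin.lastCases ?_ h1 i
    have h2 : ∑ k : Fin n, (n + 1) • s k.castSucc = n • ∑ j, s j := by
      simp [h1]
    have h3 : (n + 1) • ∑ j, s j = ∑ k : Fin n, (n + 1) • s k.castSucc + (n + 1) • s (Fin.last n) := by
      rw [Finset.smul_sum, Fin.sum_univ_castSucc]
    rw [h2, succ_nsmul, add_right_inj] at h3
    exact h3.symm
  · intro h
    refine AddMonoidHom.mem_ker.2 (funext fun k => ?_)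
    rw [fDual_apply, h, sub_self]
    rfl

theorem const_mem_NDual {n : ℕ} (a : UnitAddCircle) : (fun _ => a : Torus (n + 1)) ∈ NDual n := by
  rw [mem_NDual_iff]
  simp

theorem mem_range_fDeltaT_iff {n : ℕ} {t : Torus (n + 1)} :
    t ∈ (fDeltaT n).range ↔ ∑ i, t i = 0 := by
  constructor
  · rintro ⟨y, rfl⟩
    simp only [fDeltaT, torusHomT, AddMonoidHom.coe_mk, ZeroHom.coe_mk]
    rw [Finset.sum_comm]
    simp [vertexDual_eq, sub_smul, ite_smul, Finset.sum_sub_distrib]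
  · intro h
    refine ⟨fun k => t k.castSucc, funext fun i => ?_⟩
    simp only [fDeltaT, torusHomT, AddMonoidHom.coe_mk, ZeroHom.coe_mk]
    rw [Fin.sum_univ_castSucc] at h
    refine Fin.lastCases ?_ (fun k => ?_) i
    · simp only [vertexDual_eq, (Fin.castSucc_lt_last _).ne', if_false, if_true, zero_sub, neg_smul,
        one_smul, Finset.sum_neg_distrib]
      exact (eq_neg_of_add_eq_zero_right h).symm
    · simp [vertexDual_eq, ite_smul, (Fin.castSucc_lt_last _).ne]

theorem coe_realHomT {n : ℕ} (w : Fin (n + 1) → Fin n → ℤ) (y : Fin n → ℝ) :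
    (fun i => ((realHomT w y i : ℝ) : UnitAddCircle))
      = torusHomT w (fun k => ((y k : ℝ) : UnitAddCircle)) := by
  ext i
  have : ((∑ k, (w i k : ℝ) * y k : ℝ) : UnitAddCircle)
      = ∑ k, (((w i k : ℝ) * y k : ℝ) : UnitAddCircle) :=
    map_sum (QuotientAddGroup.mk' (AddSubgroup.zmultiples (1 : ℝ))) _ _
  simp only [realHomT, torusHomT, LinearMap.coe_mk, AddHom.coe_mk, AddMonoidHom.coe_mk,
    ZeroHom.coe_mk, this]
  refine Finset.sum_congr rfl fun k _ => ?_
  rw [← zsmul_eq_mul, AddCircle.coe_zsmul]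

theorem coe_mem_range_torusHomT {n : ℕ} {w : Fin (n + 1) → Fin n → ℤ} {v : Fin (n + 1) → ℝ}
    (hv : v ∈ LinearMap.range (realHomT w)) :
    (fun i => ((v i : ℝ) : UnitAddCircle)) ∈ (torusHomT w).range := by
  obtain ⟨y, rfl⟩ := hv
  exact ⟨_, (coe_realHomT w y).symm⟩

theorem Torus.exists_coe {m : ℕ} (t : Torus m) :
    ∃ y : Fin m → ℝ, t = fun i => ((y i : ℝ) : UnitAddCircle) := by
  choose y hy using fun i => QuotientAddGroup.mk_surjective (t i)
  exact ⟨y, funext fun i => (hy i).symm⟩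

/-- Lifting inside the linear range, rather than coordinatewise, allows two points of the image
torus to be joined by a segment that stays in it. -/
theorem exists_realHomT_coe {n : ℕ} {w : Fin (n + 1) → Fin n → ℤ} {t : Torus (n + 1)}
    (ht : t ∈ (torusHomT w).range) :
    ∃ y : Fin n → ℝ, t = fun i => ((realHomT w y i : ℝ) : UnitAddCircle) := by
  obtain ⟨s, rfl⟩ := ht
  obtain ⟨y, rfl⟩ := Torus.exists_coe s
  exact ⟨y, (coe_realHomT w y).symm⟩

theorem sum_eq_zero_of_mem_range_realHomT_vertexDual {n : ℕ} {v : Fin (n + 1) → ℝ}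
    (hv : v ∈ LinearMap.range (realHomT (vertexDual n))) : ∑ i, v i = 0 := by
  obtain ⟨y, rfl⟩ := hv
  simp only [realHomT, LinearMap.coe_mk, AddHom.coe_mk]
  rw [Finset.sum_comm]
  simp [vertexDual_eq, sub_mul, Finset.sum_sub_distrib]

/-! ### The level set of the moment maps -/

theorem sum_sq_of_mem_Xtilde {n : ℕ} {k₁ k₂ : ℝ} {p : Ambient n} (hp : p ∈ Xtilde n k₁ k₂) :
    ∑ i, p.2.1 i ^ 2 = -k₁ / Real.pi := by
  obtain ⟨_, _, _, h, _⟩ := hp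
  rw [← h, mu1, neg_neg, mul_div_cancel_left₀ _ Real.pi_ne_zero]

theorem mu2_eq_sum_log {n : ℕ} {r : Fin (n + 1) → ℝ} (hr : ∀ i, 0 < r i) :
    mu2 r = -(1 / (2 * Real.pi) * ∑ i, Real.log (r i)) := by
  rw [mu2, Real.log_prod fun i _ => (hr i).ne']

theorem sum_log_of_mem_Xtilde {n : ℕ} {k₁ k₂ : ℝ} {p : Ambient n} (hp : p ∈ Xtilde n k₁ k₂) :
    ∑ i, Real.log (p.2.1 i) = -(2 * Real.pi * k₂) := by
  obtain ⟨hr, _, _, _, h⟩ := hp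
  rw [← h, mu2_eq_sum_log hr]
  field_simp

theorem sq_lt_of_mem_Xtilde {n : ℕ} (hn : 1 ≤ n) {k₁ k₂ : ℝ} {p : Ambient n}
    (hp : p ∈ Xtilde n k₁ k₂) (i : Fin (n + 1)) : p.2.1 i ^ 2 < -k₁ / Real.pi := by
  rw [← sum_sq_of_mem_Xtilde hp]
  -- Strictness comes from a second positive summand, which exists because `n ≥ 1`.
  have : Nontrivial (Fin (n + 1)) := Fin.nontrivial_iff_two_le.2 (by omega)
  obtain ⟨j, hj⟩ := exists_ne i
  exact Finset.single_lt_sum hj (Finset.mem_univ i) (Finset.mem_univ j)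
    (pow_pos (hp.1 j) 2) fun k _ _ => (pow_pos (hp.1 k) 2).le

/-- The value of `|z_i|²` at a point with `r_i = ρ`. -/
noncomputable def heightSq (k₁ ρ : ℝ) : ℝ :=
  (Real.log (-k₁ / Real.pi) - 2 * Real.log ρ) / (4 * Real.pi ^ 2)

theorem heightSq_pos {k₁ ρ : ℝ} (hρ : 0 < ρ) (h : ρ ^ 2 < -k₁ / Real.pi) : 0 < heightSq k₁ ρ := by
  have h1 := Real.log_lt_log (pow_pos hρ 2) h
  rw [Real.log_pow] at h1
  refine div_pos ?_ (by positivity)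
  push_cast at h1
  linarith

/-- This translates the level of `μ₁` into the equation of the image. -/
theorem exp_heightSq {k₁ ρ : ℝ} (hk : 0 < -k₁ / Real.pi) (hρ : 0 < ρ) :
    Real.exp (-4 * Real.pi ^ 2 * heightSq k₁ ρ) = ρ ^ 2 / (-k₁ / Real.pi) := by
  have : -4 * Real.pi ^ 2 * heightSq k₁ ρ = Real.log (ρ ^ 2 / (-k₁ / Real.pi)) := by
    rw [Real.log_div (pow_pos hρ 2).ne' hk.ne', Real.log_pow, heightSq]
    field_simp
    push_cast
    ring
  rw [this, Real.exp_log (div_pos (pow_pos hρ 2) hk)]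

/-- This translates the level of `μ₂` into the sphere of radius `ρ₂`. -/
theorem sum_heightSq {n : ℕ} {k₁ k₂ : ℝ} {p : Ambient n} (hp : p ∈ Xtilde n k₁ k₂) :
    ∑ i, heightSq k₁ (p.2.1 i)
      = ((n : ℝ) + 1) / (4 * Real.pi ^ 2) * Real.log (-k₁ / Real.pi) + k₂ / Real.pi := by
  simp only [heightSq]
  rw [← Finset.sum_div, Finset.sum_sub_distrib, ← Finset.mul_sum, sum_log_of_mem_Xtilde hp]
  simp only [Finset.sum_const, Finset.card_univ, Fintype.card_fin, nsmul_eq_mul]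
  field_simp
  push_cast
  ring

theorem level_pos {n : ℕ} {k₁ k₂ : ℝ}
    (hk : (n : ℝ) + 1 < -k₁ / Real.pi * Real.exp (4 * Real.pi / ((n : ℝ) + 1) * k₂)) :
    0 < -k₁ / Real.pi := by
  have : (0 : ℝ) < -k₁ / Real.pi * Real.exp (4 * Real.pi / ((n : ℝ) + 1) * k₂) :=
    lt_trans (by positivity) hk
  exact pos_of_mul_pos_left this (Real.exp_pos _).le

theorem log_lt_of_level {n : ℕ} {k₁ k₂ : ℝ}
    (hk : (n : ℝ) + 1 < -k₁ / Real.pi * Real.exp (4 * Real.pi / ((n : ℝ) + 1) * k₂)) :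
    Real.log ((n : ℝ) + 1) < Real.log (-k₁ / Real.pi) + 4 * Real.pi / ((n : ℝ) + 1) * k₂ := by
  have := Real.log_lt_log (by positivity) hk
  rwa [Real.log_mul (level_pos hk).ne' (Real.exp_pos _).ne', Real.log_exp] at this

theorem rho2_radicand_pos {n : ℕ} {k₁ k₂ : ℝ}
    (hk : (n : ℝ) + 1 < -k₁ / Real.pi * Real.exp (4 * Real.pi / ((n : ℝ) + 1) * k₂)) :
    0 < ((n : ℝ) + 1) / (4 * Real.pi ^ 2) * Real.log (-k₁ / Real.pi) + k₂ / Real.pi := by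
  have h1 := log_lt_of_level hk
  have h2 : 0 ≤ Real.log ((n : ℝ) + 1) := Real.log_nonneg (by linarith [n.cast_nonneg (α := ℝ)])
  have h3 : 0 < ((n : ℝ) + 1) / (4 * Real.pi ^ 2) *
      (Real.log (-k₁ / Real.pi) + 4 * Real.pi / ((n : ℝ) + 1) * k₂) :=
    mul_pos (by positivity) (h2.trans_lt h1)
  convert h3 using 1
  field_simp

theorem rho2_sq {n : ℕ} {k₁ k₂ : ℝ}
    (hk : (n : ℝ) + 1 < -k₁ / Real.pi * Real.exp (4 * Real.pi / ((n : ℝ) + 1) * k₂)) :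
    rho2 n k₁ k₂ ^ 2
      = ((n : ℝ) + 1) / (4 * Real.pi ^ 2) * Real.log (-k₁ / Real.pi) + k₂ / Real.pi :=
  Real.sq_sqrt (rho2_radicand_pos hk).le

/-- The differentials of `μ₁` and `μ₂` are independent on the level set, since the `r_i` do not
all agree there. -/
theorem exists_sq_ne_of_mem_Xtilde {n : ℕ} {k₁ k₂ : ℝ}
    (hk : (n : ℝ) + 1 < -k₁ / Real.pi * Real.exp (4 * Real.pi / ((n : ℝ) + 1) * k₂))
    {p : Ambient n} (hp : p ∈ Xtilde n k₁ k₂) : ∃ i j, p.2.1 i ^ 2 ≠ p.2.1 j ^ 2 := by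
  -- With all `r_i` equal, the two levels would force equality in `hk`: this is the equality case of
  -- the inequality of arithmetic and geometric means.
  by_contra! h
  have h0 := hp.1 0
  have h1 : ((n : ℝ) + 1) * p.2.1 0 ^ 2 = -k₁ / Real.pi := by
    rw [← sum_sq_of_mem_Xtilde hp, Finset.sum_congr rfl fun i _ => h i 0]
    simp
  have h2 : ((n : ℝ) + 1) * Real.log (p.2.1 0) = -(2 * Real.pi * k₂) := by
    rw [← sum_log_of_mem_Xtilde hp, Finset.sum_congr rfl fun i _ => by
      rw [(sq_eq_sq₀ (hp.1 i).le h0.le).1 (h i 0)]]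
    simp
  have h3 := log_lt_of_level hk
  rw [← h1, Real.log_mul (by positivity) (by positivity), Real.log_pow] at h3
  have h4 : 4 * Real.pi / ((n : ℝ) + 1) * k₂ = -(2 * Real.log (p.2.1 0)) := by
    have : (n : ℝ) + 1 ≠ 0 := by positivity
    field_simp
    linarith
  rw [h4] at h3
  push_cast at h3
  linarith

/-! ### Curves in the level set -/

theorem hasStrictFDerivAt_mu1 {n : ℕ} (r : Fin (n + 1) → ℝ) :
    HasStrictFDerivAt (mu1 (n := n))
      (-(Real.pi • ∑ i, (2 * r i) • ContinuousLinearMap.proj (R := ℝ) (φ := fun _ => ℝ) i)) r := by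
  have h : ∀ i, HasStrictFDerivAt (fun r : Fin (n + 1) → ℝ => r i ^ 2)
      ((2 * r i) • ContinuousLinearMap.proj (R := ℝ) (φ := fun _ => ℝ) i) r := fun i => by
    simpa using (hasStrictFDerivAt_apply (𝕜 := ℝ) (F' := fun _ : Fin (n + 1) => ℝ) i r).pow 2
  exact ((HasStrictFDerivAt.fun_sum fun i _ => h i).const_mul Real.pi).fun_neg

theorem hasStrictFDerivAt_mu2 {n : ℕ} {r : Fin (n + 1) → ℝ} (hr : ∀ i, 0 < r i) :
    HasStrictFDerivAt (mu2 (n := n))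
      (-((1 / (2 * Real.pi)) •
        ∑ i, (r i)⁻¹ • ContinuousLinearMap.proj (R := ℝ) (φ := fun _ => ℝ) i)) r := by
  have h : ∀ i, HasStrictFDerivAt (fun r : Fin (n + 1) → ℝ => Real.log (r i))
      ((r i)⁻¹ • ContinuousLinearMap.proj (R := ℝ) (φ := fun _ => ℝ) i) r := fun i =>
    (hasStrictFDerivAt_apply (𝕜 := ℝ) (F' := fun _ : Fin (n + 1) => ℝ) i r).log (hr i).ne'
  refine (((HasStrictFDerivAt.fun_sum fun i _ => h i).const_mul
    (1 / (2 * Real.pi))).fun_neg).congr_of_eventuallyEq ?_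
  have hpos : ∀ᶠ s in nhds r, ∀ i, 0 < s i :=
    Filter.eventually_all.2 fun i => (continuous_apply i).continuousAt.eventually_const_lt (hr i)
  filter_upwards [hpos] with s hs using (mu2_eq_sum_log hs).symm

theorem fderiv_mu1_apply {n : ℕ} (r v : Fin (n + 1) → ℝ) :
    fderiv ℝ mu1 r v = -(Real.pi * ∑ i, 2 * r i * v i) := by
  rw [(hasStrictFDerivAt_mu1 r).hasFDerivAt.fderiv]
  simp

theorem fderiv_mu2_apply {n : ℕ} {r : Fin (n + 1) → ℝ} (hr : ∀ i, 0 < r i)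
    (v : Fin (n + 1) → ℝ) :
    fderiv ℝ mu2 r v = -(1 / (2 * Real.pi) * ∑ i, v i / r i) := by
  rw [(hasStrictFDerivAt_mu2 hr).hasFDerivAt.fderiv]
  simp [div_eq_inv_mul]

/-- Vectors supported on `i` and `j` suffice: they lead to a `2 × 2` system whose determinant is a
nonzero multiple of `r_i² - r_j²`. -/
theorem range_fderiv_mu_eq_top {n : ℕ} {r : Fin (n + 1) → ℝ} (hr : ∀ i, 0 < r i)
    {i j : Fin (n + 1)} (hij : r i ^ 2 ≠ r j ^ 2) :
    (((fderiv ℝ mu1 r).prod (fderiv ℝ mu2 r) :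
      (Fin (n + 1) → ℝ) →L[ℝ] ℝ × ℝ) : (Fin (n + 1) → ℝ) →ₗ[ℝ] ℝ × ℝ).range = ⊤ := by
  have hne : i ≠ j := fun h => hij (by rw [h])
  have hd : r i ^ 2 - r j ^ 2 ≠ 0 := sub_ne_zero.2 hij
  have hi := (hr i).ne'
  have hj := (hr j).ne'
  have hπ := Real.pi_ne_zero
  rw [LinearMap.range_eq_top]
  rintro ⟨a, b⟩
  set A := -(a / (2 * Real.pi)) with hA
  set B := -(2 * Real.pi * b) with hB
  -- `r_i v_i + r_j v_j = A` and `v_i / r_i + v_j / r_j = B`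
  refine ⟨Pi.single i (r i * (A - r j ^ 2 * B) / (r i ^ 2 - r j ^ 2)) +
    Pi.single j (r j * (r i ^ 2 * B - A) / (r i ^ 2 - r j ^ 2)), ?_⟩
  simp only [ContinuousLinearMap.coe_coe, ContinuousLinearMap.prod_apply, fderiv_mu1_apply,
    fderiv_mu2_apply hr, Pi.add_apply, mul_add, add_div, Finset.sum_add_distrib]
  refine Prod.ext ?_ ?_
  · simp only [Pi.single_apply, mul_ite, mul_zero, Finset.sum_ite_eq', Finset.mem_univ, if_true]
    rw [hA, hB]
    field_simp
    ring
  · simp only [Pi.single_apply, ite_div, zero_div, Finset.sum_ite_eq', Finset.mem_univ, if_true]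
    rw [hA, hB]
    field_simp
    ring

/-- A local lift is constrained only on `𝕏̃`, so its derivative in a tangent direction has to be
read off along a curve inside `𝕏̃`. The angles move linearly, the radii by the implicit function
theorem. -/
theorem exists_curve_of_mem_tangentX {n : ℕ} {k₁ k₂ : ℝ}
    (hk : (n : ℝ) + 1 < -k₁ / Real.pi * Real.exp (4 * Real.pi / ((n : ℝ) + 1) * k₂))
    {x : Coord n} (hx : coordMap x ∈ Xtilde n k₁ k₂) {u : Coord n} (hu : u ∈ tangentX x) :
    ∃ γ : ℝ → Coord n, γ 0 = x ∧ HasDerivAt γ u 0 ∧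
      ∀ᶠ t in nhds 0, coordMap (γ t) ∈ Xtilde n k₁ k₂ := by
  obtain ⟨hu1, hu3, hm1, hm2⟩ := hu
  obtain ⟨i, j, hij⟩ := exists_sq_ne_of_mem_Xtilde hk hx
  obtain ⟨hr, hθ, hη, hk1, hk2⟩ := hx
  simp only [coordMap] at hij hr hθ hη hk1 hk2
  let f : (Fin (n + 1) → ℝ) → ℝ × ℝ := fun r => (mu1 r, mu2 r)
  let f' : (Fin (n + 1) → ℝ) →L[ℝ] ℝ × ℝ := (fderiv ℝ mu1 x.2.1).prod (fderiv ℝ mu2 x.2.1)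
  have hf : HasStrictFDerivAt f f' x.2.1 := by
    have h1 := hasStrictFDerivAt_mu1 x.2.1
    have h2 := hasStrictFDerivAt_mu2 hr
    rw [← h1.hasFDerivAt.fderiv] at h1
    rw [← h2.hasFDerivAt.fderiv] at h2
    exact h1.prodMk h2
  have hf' : (f' : (Fin (n + 1) → ℝ) →ₗ[ℝ] ℝ × ℝ).range = ⊤ := range_fderiv_mu_eq_top hr hij
  let w : (f' : (Fin (n + 1) → ℝ) →ₗ[ℝ] ℝ × ℝ).ker :=
    ⟨u.2.1, LinearMap.mem_ker.2 (Prod.ext hm1 hm2)⟩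
  -- `Φ` parametrizes the level set of `(μ₁, μ₂)` by the kernel of the differential, and its
  -- derivative at `0` is the inclusion.
  let Φ := HasStrictFDerivAt.implicitFunction f f' hf hf' (f x.2.1)
  have hΦ0 : Φ 0 = x.2.1 := hf.implicitFunction_apply_image hf'
  have hlin : HasDerivAt (fun t : ℝ => t • w) w 0 := by
    simpa using (hasDerivAt_id (0 : ℝ)).smul_const w
  have hΦ : HasDerivAt (fun t : ℝ => Φ (t • w)) u.2.1 0 :=
    (hf.to_implicitFunction hf').hasFDerivAt.comp_hasDerivAt_of_eq 0 hlin (zero_smul ℝ w).symm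
  have hline : ∀ a b : Fin (n + 1) → ℝ, HasDerivAt (fun t : ℝ => a + t • b) b 0 := fun a b => by
    simpa using ((hasDerivAt_id (0 : ℝ)).smul_const b).const_add a
  refine ⟨fun t => (x.1 + t • u.1, Φ (t • w), x.2.2 + t • u.2.2), ?_,
    (hline _ _).prodMk (hΦ.prodMk (hline _ _)), ?_⟩
  · simp [hΦ0]
  · have hpos : ∀ᶠ t in nhds (0 : ℝ), ∀ i, 0 < Φ (t • w) i := by
      refine Filter.eventually_all.2 fun i => ?_
      refine ((continuous_apply i).continuousAt.comp hΦ.continuousAt).eventually_const_lt ?_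
      simpa [hΦ0] using hr i
    have hlev : ∀ᶠ t in nhds (0 : ℝ), f (Φ (t • w)) = f x.2.1 := by
      have ht : Filter.Tendsto (fun t : ℝ => (f x.2.1, t • w)) (nhds 0) (nhds (f x.2.1, 0)) := by
        have := hlin.continuousAt.tendsto
        rw [zero_smul] at this
        exact tendsto_const_nhds.prodMk_nhds this
      exact ht.eventually (hf.map_implicitFunction_eq hf')
    have hcoe : ∀ (a b : Fin (n + 1) → ℝ) (t : ℝ),
        (fun i => (((a + t • b) i : ℝ) : UnitAddCircle))
          = (fun i => ((a i : ℝ) : UnitAddCircle)) + fun i => (((t • b) i : ℝ) : UnitAddCircle) :=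
      fun a b t => rfl
    filter_upwards [hpos, hlev] with t h1 h2
    refine ⟨h1, ?_, ?_, (congrArg Prod.fst h2).trans hk1, (congrArg Prod.snd h2).trans hk2⟩
    · simp only [coordMap]
      rw [hcoe]
      exact add_mem hθ (coe_mem_range_torusHomT (Submodule.smul_mem _ t hu1))
    · simp only [coordMap]
      rw [hcoe]
      exact add_mem hη (coe_mem_range_torusHomT (Submodule.smul_mem _ t hu3))

/-! ### The map to `H^n` -/

theorem DualToric.mk_eq_mk_iff {n : ℕ} {z w : Fin (n + 1) → ℂ} (hz : z ≠ 0) (hw : w ≠ 0) :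
    DualToric.mk z hz = DualToric.mk w hw ↔ ∃ s ∈ NDual n, ∃ a : ℂ, a ≠ 0 ∧
      ∀ i, w i = a * ((AddCircle.toCircle (s i) : Circle) : ℂ) * z i := by
  refine (Quotient.eq (r := Hsetoid n)).trans ?_
  refine exists_congr fun s => and_congr_right fun _ => ?_
  rw [projPhase, Projectivization.map_mk, Projectivization.mk_eq_mk_iff']
  constructor
  · rintro ⟨a, ha⟩
    refine ⟨a, ?_, fun i => ?_⟩
    · rintro rfl
      exact hw (by rw [← ha, zero_smul])
    · rw [← ha, Pi.smul_apply, phase_apply, smul_eq_mul, mul_assoc]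
  · rintro ⟨a, _, ha⟩
    exact ⟨a, funext fun i => by rw [ha, Pi.smul_apply, phase_apply, smul_eq_mul, mul_assoc]⟩

/-- The element of `N_{Δ*}` relating two lifts may vary from point to point without any continuity;
taking `(n+1)`-th powers eliminates it. -/
theorem toCircle_pow_eq_of_mem_NDual {n : ℕ} {s : Torus (n + 1)} (hs : s ∈ NDual n)
    (i j : Fin (n + 1)) :
    ((AddCircle.toCircle (s i) : Circle) : ℂ) ^ (n + 1)
      = ((AddCircle.toCircle (s j) : Circle) : ℂ) ^ (n + 1) := by
  rw [← Circle.coe_pow, ← Circle.coe_pow, ← AddCircle.toCircle_nsmul, ← AddCircle.toCircle_nsmul,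
    mem_NDual_iff.1 hs, mem_NDual_iff.1 hs]

/-- Homogeneous coordinates, on the sphere of radius `ρ₂`, of the image of a point of `𝕏̃`. -/
noncomputable def homogCoord {n : ℕ} (k₁ : ℝ) (p : Ambient n) (i : Fin (n + 1)) : ℂ :=
  (√(heightSq k₁ (p.2.1 i)) : ℝ) * ((AddCircle.toCircle (-(p.2.2 i)) : Circle) : ℂ)

theorem norm_homogCoord_sq {n : ℕ} {k₁ : ℝ} {p : Ambient n} {i : Fin (n + 1)}
    (h : 0 ≤ heightSq k₁ (p.2.1 i)) : ‖homogCoord k₁ p i‖ ^ 2 = heightSq k₁ (p.2.1 i) := by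
  rw [homogCoord, norm_mul, Circle.norm_coe, mul_one, Complex.norm_real, Real.norm_eq_abs, sq_abs,
    Real.sq_sqrt h]

theorem heightSq_pos_of_mem_Xtilde {n : ℕ} (hn : 1 ≤ n) {k₁ k₂ : ℝ} {p : Ambient n}
    (hp : p ∈ Xtilde n k₁ k₂) (i : Fin (n + 1)) : 0 < heightSq k₁ (p.2.1 i) :=
  heightSq_pos (hp.1 i) (sq_lt_of_mem_Xtilde hn hp i)

theorem homogCoord_apply_ne_zero {n : ℕ} {k₁ : ℝ} {p : Ambient n} {i : Fin (n + 1)}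
    (h : 0 < heightSq k₁ (p.2.1 i)) : homogCoord k₁ p i ≠ 0 :=
  mul_ne_zero (Complex.ofReal_ne_zero.2 (Real.sqrt_pos.2 h).ne') (Circle.coe_ne_zero _)

theorem homogCoord_ne_zero {n : ℕ} (hn : 1 ≤ n) {k₁ k₂ : ℝ} {p : Ambient n}
    (hp : p ∈ Xtilde n k₁ k₂) : homogCoord k₁ p ≠ 0 := fun h =>
  homogCoord_apply_ne_zero (heightSq_pos_of_mem_Xtilde hn hp 0) (congrFun h 0)

theorem homogCoord_eq_of_sub_mem {n : ℕ} {k₁ : ℝ} {p q : Ambient n} (hr : q.2.1 = p.2.1)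
    (i : Fin (n + 1)) : homogCoord k₁ q i
      = 1 * ((AddCircle.toCircle ((-(q.2.2 - p.2.2)) i) : Circle) : ℂ) * homogCoord k₁ p i := by
  have : -(q.2.2 i) = (-(q.2.2 - p.2.2)) i + -(p.2.2 i) := by
    simp only [Pi.neg_apply, Pi.sub_apply]
    abel
  rw [homogCoord, this, AddCircle.toCircle_add, hr, homogCoord, Circle.coe_mul]
  ring

/-- The map `π₂`, induced by `(θ, r, η) ↦ [√(heightSq r_i) e^{-2π i η_i}]`. -/
noncomputable def toricMap (n : ℕ) (hn : 1 ≤ n) (k₁ k₂ : ℝ) : XSpace n k₁ k₂ → DualToric n :=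
  Quotient.lift (fun p : Xtilde n k₁ k₂ =>
      DualToric.mk (homogCoord k₁ p.1) (homogCoord_ne_zero hn p.2))
    fun _ _ h => (DualToric.mk_eq_mk_iff _ _).2
      ⟨_, neg_mem h.2.2.1, 1, one_ne_zero, homogCoord_eq_of_sub_mem h.2.1⟩

theorem toricMap_toX {n : ℕ} (hn : 1 ≤ n) {k₁ k₂ : ℝ} {x : Coord n}
    (hx : coordMap x ∈ Xtilde n k₁ k₂) : toricMap n hn k₁ k₂ (toX x hx)
      = DualToric.mk (homogCoord k₁ (coordMap x)) (homogCoord_ne_zero hn hx) := rfl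

theorem toricMap_eq_iff {n : ℕ} (hn : 1 ≤ n) {k₁ k₂ : ℝ} (p q : Xtilde n k₁ k₂) :
    toricMap n hn k₁ k₂ (Quotient.mk _ p) = toricMap n hn k₁ k₂ (Quotient.mk _ q) ↔
      q.1.2.1 = p.1.2.1 ∧ q.1.2.2 - p.1.2.2 ∈ DDual n := by
  change DualToric.mk (homogCoord k₁ p.1) _ = DualToric.mk (homogCoord k₁ q.1) _ ↔ _
  rw [DualToric.mk_eq_mk_iff]
  constructor
  · rintro ⟨s, hs, a, ha, h⟩
    have hp := heightSq_pos_of_mem_Xtilde hn p.2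
    have hq := heightSq_pos_of_mem_Xtilde hn q.2
    have hn1 : ∀ i, heightSq k₁ (q.1.2.1 i) = ‖a‖ ^ 2 * heightSq k₁ (p.1.2.1 i) := fun i => by
      rw [← norm_homogCoord_sq (hq i).le, ← norm_homogCoord_sq (hp i).le, h i, norm_mul, norm_mul,
        Circle.norm_coe, mul_one, mul_pow]
    -- Both heights have the same sum, fixed by `k₁` and `k₂`.
    have ha1 : ‖a‖ ^ 2 = 1 := by
      have h1 : ∑ i, heightSq k₁ (q.1.2.1 i) = ‖a‖ ^ 2 * ∑ i, heightSq k₁ (p.1.2.1 i) := by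
        rw [Finset.mul_sum]
        exact Finset.sum_congr rfl fun i _ => hn1 i
      have h2 : 0 < ∑ i, heightSq k₁ (p.1.2.1 i) :=
        Finset.sum_pos (fun i _ => hp i) Finset.univ_nonempty
      rw [sum_heightSq q.2, ← sum_heightSq p.2] at h1
      exact (mul_right_cancel₀ h2.ne' (by rw [one_mul]; exact h1)).symm
    have hr : q.1.2.1 = p.1.2.1 := by
      ext i
      have h1 := hn1 i
      rw [ha1, one_mul, heightSq, heightSq, div_left_inj' (by positivity)] at h1
      exact Real.log_injOn_pos (q.2.1 i) (p.2.1 i) (by linarith)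
    refine ⟨hr, ?_, (fDeltaT n).range.sub_mem q.2.2.2.1 p.2.2.2.1⟩
    -- the constant phase of `a` lies in `N_{Δ*}`
    obtain ⟨b, hb⟩ : ∃ b : UnitAddCircle, ((AddCircle.toCircle b : Circle) : ℂ) = a := by
      have ha2 : ‖a‖ = 1 :=
        (pow_eq_one_iff_of_nonneg (norm_nonneg a) two_ne_zero).1 ha1
      obtain ⟨b, hb⟩ := (AddCircle.homeomorphCircle (T := (1 : ℝ)) one_ne_zero).surjective
        ⟨a, mem_sphere_zero_iff_norm.2 ha2⟩
      refine ⟨b, ?_⟩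
      rw [AddCircle.homeomorphCircle_apply] at hb
      rw [hb]
    have hη : ∀ i, -(q.1.2.2 i) = b + s i + -(p.1.2.2 i) := fun i => by
      have h1 := h i
      rw [homogCoord, homogCoord, hr, ← hb] at h1
      have h2 : ((√(heightSq k₁ (p.1.2.1 i)) : ℝ) : ℂ) ≠ 0 :=
        Complex.ofReal_ne_zero.2 (Real.sqrt_pos.2 (hp i)).ne'
      refine AddCircle.injective_toCircle (T := (1 : ℝ)) one_ne_zero (Circle.ext ?_)
      rw [AddCircle.toCircle_add, AddCircle.toCircle_add, Circle.coe_mul, Circle.coe_mul]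
      refine mul_left_cancel₀ h2 (h1.trans ?_)
      ring
    have : q.1.2.2 - p.1.2.2 = -((fun _ => b) + s) := by
      ext i
      have := hη i
      simp only [Pi.sub_apply, Pi.neg_apply, Pi.add_apply]
      rw [eq_neg_iff_add_eq_zero, sub_add_eq_add_sub, sub_eq_zero]
      rw [neg_eq_iff_eq_neg] at this
      rw [this]
      abel
    rw [this]
    exact (NDual n).neg_mem ((NDual n).add_mem (const_mem_NDual b) hs)
  · rintro ⟨hr, hη⟩
    exact ⟨_, neg_mem hη.1, 1, one_ne_zero, homogCoord_eq_of_sub_mem hr⟩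

theorem homogCoord_coordMap {n : ℕ} (k₁ : ℝ) (x : Coord n) (i : Fin (n + 1)) :
    homogCoord k₁ (coordMap x) i = (√(heightSq k₁ (x.2.1 i)) : ℝ) *
      Complex.exp ((-(2 * Real.pi * x.2.2 i) : ℝ) * Complex.I) := by
  rw [homogCoord]
  simp only [coordMap]
  rw [← AddCircle.coe_neg, AddCircle.toCircle_apply_mk, Circle.coe_exp]
  congr 5
  ring

theorem isLocalLift_toricMap {n : ℕ} (hn : 1 ≤ n) {k₁ k₂ : ℝ} {x : Coord n}
    (hx : coordMap x ∈ Xtilde n k₁ k₂) :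
    IsLocalLift (toricMap n hn k₁ k₂) x fun y => homogCoord k₁ (coordMap y) := by
  have hcoord : ∀ i, ContDiff ℝ ∞ fun y : Coord n => y.2.1 i := fun i => by fun_prop
  -- On this open set the argument of the logarithm and that of the square root are both nonzero.
  refine ⟨{y | ∀ i, 0 < y.2.1 i ∧ y.2.1 i ^ 2 < -k₁ / Real.pi}, ?_, ?_, ?_, ?_⟩
  · simp only [Set.ofPred_forall]
    exact isOpen_iInter_of_finite fun i =>
      (isOpen_lt continuous_const (hcoord i).continuous).inter
        (isOpen_lt ((hcoord i).continuous.pow 2) continuous_const)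
  · exact fun i => ⟨hx.1 i, sq_lt_of_mem_Xtilde hn hx i⟩
  · refine contDiffOn_pi.2 fun i => ?_
    simp only [homogCoord_coordMap]
    refine ContDiffOn.mul (Complex.ofRealCLM.contDiff.comp_contDiffOn ?_) ?_
    · refine ContDiffOn.sqrt ?_ fun y hy => (heightSq_pos (hy i).1 (hy i).2).ne'
      unfold heightSq
      exact (contDiffOn_const.sub (contDiffOn_const.mul
        ((hcoord i).contDiffOn.log fun y hy => (hy i).1.ne'))).div_const _
    · refine (Complex.contDiff_exp.comp ((Complex.ofRealCLM.contDiff.comp ?_).mul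
        contDiff_const)).contDiffOn
      exact (contDiff_const.mul (by fun_prop : ContDiff ℝ ∞ fun y : Coord n => y.2.2 i)).neg
  · exact fun y _ hy => ⟨homogCoord_ne_zero hn hy, rfl⟩

theorem toricMap_vadd {n : ℕ} (hn : 1 ≤ n) {k₁ k₂ : ℝ} (t : Torus n × Torus n)
    (p : XSpace n k₁ k₂) :
    toricMap n hn k₁ k₂ (t +ᵥ p) = (-t.2) +ᵥ toricMap n hn k₁ k₂ p := by
  induction p using Quotient.inductionOn with
  | _ p =>
    have hne := homogCoord_ne_zero hn p.2
    have h : (-t.2) +ᵥ toricMap n hn k₁ k₂ (Quotient.mk _ p)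
        = DualToric.mk (phase (liftDual n (-t.2)) (homogCoord k₁ p.1))
          ((map_ne_zero_iff _ (phase_injective _)).2 hne) := by
      exact congrArg (Quotient.mk (Hsetoid n)) (Projectivization.map_mk _ _ _ _)
    rw [h]
    -- The lifts of `t₂` and `-t₂` are chosen independently, so their sum need not vanish; it only
    -- lies in `N_{Δ*}`.
    refine (DualToric.mk_eq_mk_iff (homogCoord_ne_zero hn
      (Xtranslate ⟨liftDelta n t.1, liftDelta_mem n t.1⟩ ⟨liftDual n t.2, liftDual_mem n t.2⟩
        p).2) _).2 ⟨liftDual n (-t.2) + liftDual n t.2, ?_, 1, one_ne_zero, fun i => ?_⟩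
    · simp [NDual, AddMonoidHom.mem_ker, fDual_liftDual]
    · rw [phase_apply]
      simp only [homogCoord, Xtranslate, Pi.add_apply, neg_add, AddCircle.toCircle_add,
        AddCircle.toCircle_neg, Circle.coe_mul, Circle.coe_inv]
      field_simp [Circle.coe_ne_zero]

theorem range_toricMap {n : ℕ} (hn : 1 ≤ n) {k₁ k₂ : ℝ}
    (hk : (n : ℝ) + 1 < -k₁ / Real.pi * Real.exp (4 * Real.pi / ((n : ℝ) + 1) * k₂)) :
    Set.range (toricMap n hn k₁ k₂) =
      {h : DualToric n | ∃ (z : Fin (n + 1) → ℂ) (hz : z ≠ 0), h = DualToric.mk z hz ∧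
        ∑ i, ‖z i‖ ^ 2 = rho2 n k₁ k₂ ^ 2 ∧
        ∑ i, Real.exp (-4 * Real.pi ^ 2 * ‖z i‖ ^ 2) = 1} := by
  have hA := level_pos hk
  have hπ := Real.pi_pos
  ext y
  constructor
  · rintro ⟨p, rfl⟩
    induction p using Quotient.inductionOn with
    | _ p =>
      have hpos := heightSq_pos_of_mem_Xtilde hn p.2
      refine ⟨homogCoord k₁ p.1, homogCoord_ne_zero hn p.2, rfl, ?_, ?_⟩
      · simp only [norm_homogCoord_sq (hpos _).le]
        rw [sum_heightSq p.2, rho2_sq hk]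
      · simp only [norm_homogCoord_sq (hpos _).le, exp_heightSq hA (p.2.1 _)]
        rw [← Finset.sum_div, sum_sq_of_mem_Xtilde p.2, div_self hA.ne']
  · rintro ⟨z, hz, rfl, h1, h2⟩
    rw [rho2_sq hk] at h1
    -- A vanishing coordinate contributes `1` to the sum of exponentials, and another term makes the
    -- sum exceed `1`.
    have hz0 : ∀ i, z i ≠ 0 := by
      intro i hi
      have : Nontrivial (Fin (n + 1)) := Fin.nontrivial_iff_two_le.2 (by omega)
      obtain ⟨j, hj⟩ := exists_ne i
      have h3 := Finset.single_lt_sum (f := fun i => Real.exp (-4 * Real.pi ^ 2 * ‖z i‖ ^ 2)) hj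
        (Finset.mem_univ i) (Finset.mem_univ j) (Real.exp_pos _) fun k _ _ => (Real.exp_pos _).le
      rw [h2, hi] at h3
      simp at h3
    -- The solution of `heightSq k₁ (r i) = ‖z i‖ ^ 2`.
    let r : Fin (n + 1) → ℝ := fun i =>
      Real.exp (Real.log (-k₁ / Real.pi) / 2 - 2 * Real.pi ^ 2 * ‖z i‖ ^ 2)
    have hr : ∀ i, heightSq k₁ (r i) = ‖z i‖ ^ 2 := fun i => by
      simp only [heightSq, r, Real.log_exp]
      field_simp
      ring
    have hu : ∀ i, ‖z i / (‖z i‖ : ℂ)‖ = 1 := fun i => by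
      rw [norm_div, Complex.norm_real, norm_norm, div_self (norm_ne_zero_iff.2 (hz0 i))]
    have hs : ∀ i, ∃ b : UnitAddCircle,
        ((AddCircle.toCircle b : Circle) : ℂ) * (‖z i‖ : ℂ) = z i := fun i => by
      obtain ⟨b, hb⟩ := (AddCircle.homeomorphCircle (T := (1 : ℝ)) one_ne_zero).surjective
        ⟨_, mem_sphere_zero_iff_norm.2 (hu i)⟩
      refine ⟨b, ?_⟩
      rw [AddCircle.homeomorphCircle_apply] at hb
      rw [hb]
      exact div_mul_cancel₀ _ (Complex.ofReal_ne_zero.2 (norm_ne_zero_iff.2 (hz0 i)))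
    choose s hs using hs
    -- The angles `-s i` need not sum to zero, as `Im f_Δ^*` requires. A common shift `c` with
    -- `(n+1) c = ∑ s i` corrects this, and it is invisible in `H^n`.
    obtain ⟨m, hm⟩ := torus_divisible n fun _ => ∑ i, s i
    obtain ⟨c, hc⟩ : ∃ c : UnitAddCircle, (n + 1) • c = ∑ i, s i :=
      ⟨m ⟨0, hn⟩, congrFun hm ⟨0, hn⟩⟩
    have hp : ((0, r, fun i => c - s i) : Ambient n) ∈ Xtilde n k₁ k₂ := by
      refine ⟨fun i => Real.exp_pos _, zero_mem _, mem_range_fDeltaT_iff.2 ?_, ?_, ?_⟩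
      · simp [Finset.sum_sub_distrib, hc]
      · have h3 : ∀ i, r i ^ 2 = -k₁ / Real.pi * Real.exp (-4 * Real.pi ^ 2 * ‖z i‖ ^ 2) :=
          fun i => by
            rw [← hr, exp_heightSq hA (Real.exp_pos _), mul_div_cancel₀ _ hA.ne']
        simp only [mu1, h3]
        rw [← Finset.mul_sum, h2]
        field_simp
      · rw [mu2_eq_sum_log fun i => Real.exp_pos _]
        simp only [Real.log_exp, Finset.sum_sub_distrib, ← Finset.mul_sum]
        rw [h1]
        simp only [Finset.sum_const, Finset.card_univ, Fintype.card_fin, nsmul_eq_mul]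
        field_simp
        push_cast
        ring
    refine ⟨Quotient.mk _ ⟨_, hp⟩, ?_⟩
    refine (DualToric.mk_eq_mk_iff (homogCoord_ne_zero hn hp) hz).2
      ⟨fun _ => c, const_mem_NDual c, 1, one_ne_zero, fun i => ?_⟩
    have h4 : -(c - s i) = s i + -c := by abel
    rw [homogCoord, hr, Real.sqrt_sq (norm_nonneg _), h4, AddCircle.toCircle_add,
      AddCircle.toCircle_neg, Circle.coe_mul, Circle.coe_inv]
    conv_lhs => rw [← hs i]
    have := Circle.coe_ne_zero (AddCircle.toCircle c)
    field_simp

/-! ### The differential of local lifts -/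

/-- The logarithmic derivative of the `i`-th homogeneous coordinate at `x` in the direction `u`. -/
noncomputable def logDerivCoord {n : ℕ} (k₁ : ℝ) (x u : Coord n) (i : Fin (n + 1)) : ℂ :=
  (-(u.2.1 i / x.2.1 i) / (4 * Real.pi ^ 2 * heightSq k₁ (x.2.1 i)) : ℝ) -
    (2 * Real.pi * u.2.2 i : ℝ) * Complex.I

theorem hasDerivAt_homogCoord_comp {n : ℕ} {k₁ : ℝ} {γ : ℝ → Coord n} {u : Coord n}
    (hγ : HasDerivAt γ u 0) (i : Fin (n + 1)) (hr : 0 < (γ 0).2.1 i)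
    (hh : 0 < heightSq k₁ ((γ 0).2.1 i)) :
    HasDerivAt (fun t => homogCoord k₁ (coordMap (γ t)) i)
      (logDerivCoord k₁ (γ 0) u i * homogCoord k₁ (coordMap (γ 0)) i) 0 := by
  have h1 : HasDerivAt (fun t => (γ t).2.1 i) (u.2.1 i) 0 :=
    (hasDerivAt_pi.1 ((hasFDerivAt_fst.comp_hasDerivAt (0 : ℝ)
      (hasFDerivAt_snd.comp_hasDerivAt (0 : ℝ) hγ)))) i
  have h2 : HasDerivAt (fun t => (γ t).2.2 i) (u.2.2 i) 0 :=
    (hasDerivAt_pi.1 ((hasFDerivAt_snd.comp_hasDerivAt (0 : ℝ)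
      (hasFDerivAt_snd.comp_hasDerivAt (0 : ℝ) hγ)))) i
  have h3 : HasDerivAt (fun t => √(heightSq k₁ ((γ t).2.1 i)))
      (-(2 * (u.2.1 i / (γ 0).2.1 i)) / (4 * Real.pi ^ 2) /
        (2 * √(heightSq k₁ ((γ 0).2.1 i)))) 0 :=
    ((((h1.log hr.ne').const_mul 2).const_sub _).div_const _).sqrt hh.ne'
  have h4 := ((((h2.const_mul (2 * Real.pi)).fun_neg).ofReal_comp).mul_const Complex.I).cexp
  have h5 := h3.ofReal_comp.mul h4
  simp only [homogCoord_coordMap]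
  refine h5.congr_deriv ?_
  have hs : (√(heightSq k₁ ((γ 0).2.1 i)) : ℝ) ≠ 0 := (Real.sqrt_pos.2 hh).ne'
  have h6 : -(2 * (u.2.1 i / (γ 0).2.1 i)) / (4 * Real.pi ^ 2) /
        (2 * √(heightSq k₁ ((γ 0).2.1 i))) =
      -(u.2.1 i / (γ 0).2.1 i) / (4 * Real.pi ^ 2 * heightSq k₁ ((γ 0).2.1 i)) *
        √(heightSq k₁ ((γ 0).2.1 i)) := by
    have h7 := Real.sq_sqrt hh.le
    generalize √(heightSq k₁ ((γ 0).2.1 i)) = s at hs h7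
    rw [← h7]
    field_simp
  rw [h6, logDerivCoord]
  push_cast
  ring

/-- At a point of the level set every local lift agrees with the standard one up to a common factor
and constant phases, both in absolute values and in logarithmic derivatives. -/
theorem IsLocalLift.fderiv_eq {n : ℕ} {hn : 1 ≤ n} {k₁ k₂ : ℝ}
    (hk : (n : ℝ) + 1 < -k₁ / Real.pi * Real.exp (4 * Real.pi / ((n : ℝ) + 1) * k₂))
    {x : Coord n} (hx : coordMap x ∈ Xtilde n k₁ k₂) {F : Coord n → Fin (n + 1) → ℂ}
    (hF : IsLocalLift (toricMap n hn k₁ k₂) x F) {u : Coord n} (hu : u ∈ tangentX x) :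
    ∃ c : ℂ, ∀ i, fderiv ℝ F x u i = F x i * (logDerivCoord k₁ x u i + c) := by
  obtain ⟨U, hU, hxU, hFU, hlift⟩ := hF
  obtain ⟨γ, rfl, hγ, hγX⟩ := exists_curve_of_mem_tangentX hk hx hu
  -- The ratio of `F_i / g_i` to `F_0 / g_0` is an `(n+1)`-th root of unity, written without
  -- denominators.
  have hpow : ∀ y ∈ U, coordMap y ∈ Xtilde n k₁ k₂ → ∀ i,
      F y i ≠ 0 ∧ (F y i * homogCoord k₁ (coordMap y) 0) ^ (n + 1)
        = (homogCoord k₁ (coordMap y) i * F y 0) ^ (n + 1) := by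
    intro y hyU hy i
    obtain ⟨h, hFy⟩ := hlift y hyU hy
    rw [toricMap_toX, DualToric.mk_eq_mk_iff] at hFy
    obtain ⟨s, hs, a, ha, hFa⟩ := hFy
    refine ⟨?_, ?_⟩
    · rw [hFa]
      exact mul_ne_zero (mul_ne_zero ha (Circle.coe_ne_zero _))
        (homogCoord_apply_ne_zero (heightSq_pos_of_mem_Xtilde hn hy i))
    · rw [hFa i, hFa 0]
      simp only [mul_pow, toCircle_pow_eq_of_mem_NDual hs i 0]
      ring
  have hFd : HasFDerivAt F (fderiv ℝ F (γ 0)) (γ 0) :=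
    ((hFU.contDiffAt (hU.mem_nhds hxU)).differentiableAt (by simp)).hasFDerivAt
  have hf : ∀ i, HasDerivAt (fun t => F (γ t) i) (fderiv ℝ F (γ 0) u i) 0 :=
    hasDerivAt_pi.1 (hFd.comp_hasDerivAt (0 : ℝ) hγ)
  have hg : ∀ i, HasDerivAt (fun t => homogCoord k₁ (coordMap (γ t)) i)
      (logDerivCoord k₁ (γ 0) u i * homogCoord k₁ (coordMap (γ 0)) i) 0 := fun i =>
    hasDerivAt_homogCoord_comp hγ i (hx.1 i) (heightSq_pos_of_mem_Xtilde hn hx i)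
  -- The common constant is the logarithmic derivative of `F_0 / g_0`.
  refine ⟨fderiv ℝ F (γ 0) u 0 / F (γ 0) 0 - logDerivCoord k₁ (γ 0) u 0, fun i => ?_⟩
  have h1 := ((hf i).mul (hg 0)).pow (n + 1)
  have h2 := ((hg i).mul (hf 0)).pow (n + 1)
  have hev : ∀ᶠ t in nhds (0 : ℝ), (F (γ t) i * homogCoord k₁ (coordMap (γ t)) 0) ^ (n + 1)
        = (homogCoord k₁ (coordMap (γ t)) i * F (γ t) 0) ^ (n + 1) := by
    filter_upwards [hγX, hγ.continuousAt.eventually (hU.mem_nhds hxU)] with t ht htU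
      using (hpow _ htU ht i).2
  have h3 := h1.unique (h2.congr_of_eventuallyEq hev)
  have h4 := (hpow _ hxU hx i).2
  have hFi := (hpow _ hxU hx i).1
  have hF0 := (hpow _ hxU hx 0).1
  have hGi := homogCoord_apply_ne_zero (heightSq_pos_of_mem_Xtilde hn hx i)
  have hG0 := homogCoord_apply_ne_zero (heightSq_pos_of_mem_Xtilde hn hx 0)
  simp only [Pi.mul_apply, Nat.add_sub_cancel] at h3
  generalize homogCoord k₁ (coordMap (γ 0)) i = gi at *
  generalize homogCoord k₁ (coordMap (γ 0)) 0 = g0 at *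
  generalize F (γ 0) i = fi at *
  generalize F (γ 0) 0 = f0 at *
  generalize fderiv ℝ F (γ 0) u i = dfi at *
  generalize fderiv ℝ F (γ 0) u 0 = df0 at *
  generalize logDerivCoord k₁ (γ 0) u i = di at *
  generalize logDerivCoord k₁ (γ 0) u 0 = d0 at *
  have hn0 : ((n : ℂ) + 1) ≠ 0 := by exact_mod_cast n.succ_ne_zero
  have hP : (fi * g0) ^ (n + 1) ≠ 0 := pow_ne_zero _ (mul_ne_zero hFi hG0)
  -- The derivatives of the two equal powers are divided by `n+1` times their common value.
  have h5 : (dfi / fi + d0) = (di + df0 / f0) := by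
    refine mul_left_cancel₀ (mul_ne_zero hn0 hP) ?_
    calc (((n : ℂ) + 1) * (fi * g0) ^ (n + 1)) * (dfi / fi + d0)
        = ((n + 1 : ℕ) : ℂ) * (fi * g0) ^ n * (dfi * g0 + fi * (d0 * g0)) := by
          push_cast
          field_simp
          ring
      _ = ((n + 1 : ℕ) : ℂ) * (gi * f0) ^ n * (di * gi * f0 + gi * df0) := h3
      _ = (((n : ℂ) + 1) * (gi * f0) ^ (n + 1)) * (di + df0 / f0) := by
          push_cast
          field_simp
          ring
      _ = _ := by rw [← h4]
  have h6 : dfi = fi * (dfi / fi) := by field_simp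
  rw [h6, eq_sub_of_add_eq h5]
  ring

theorem IsLocalLift.exists_norm_sq_eq {n : ℕ} {hn : 1 ≤ n} {k₁ k₂ : ℝ}
    {x : Coord n} (hx : coordMap x ∈ Xtilde n k₁ k₂) {F : Coord n → Fin (n + 1) → ℂ}
    (hF : IsLocalLift (toricMap n hn k₁ k₂) x F) :
    ∃ κ : ℝ, 0 < κ ∧ ∀ i, star (F x i) * F x i = ((κ * heightSq k₁ (x.2.1 i) : ℝ) : ℂ) := by
  obtain ⟨U, hU, hxU, -, hlift⟩ := hF
  obtain ⟨h, hFx⟩ := hlift x hxU hx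
  rw [toricMap_toX, DualToric.mk_eq_mk_iff] at hFx
  obtain ⟨s, hs, a, ha, hFa⟩ := hFx
  refine ⟨‖a‖ ^ 2, by positivity, fun i => ?_⟩
  have h1 : heightSq k₁ (x.2.1 i) = ‖homogCoord k₁ (coordMap x) i‖ ^ 2 :=
    (norm_homogCoord_sq (heightSq_pos_of_mem_Xtilde hn hx i).le).symm
  have h2 : star (F x i) * F x i = ((‖F x i‖ ^ 2 : ℝ) : ℂ) := by
    rw [Complex.star_def, mul_comm, Complex.mul_conj, Complex.normSq_eq_norm_sq]
  rw [h2, h1, hFa i, norm_mul, norm_mul, Circle.norm_coe, mul_one, mul_pow]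

/-- The Fubini–Study form on vectors given by logarithmic derivatives; adding a common constant to
these does not change it. -/
theorem fubiniStudy_mul_add_const {n : ℕ} {z : Fin (n + 1) → ℂ} {κ : ℝ} (hκ : 0 < κ)
    {h : Fin (n + 1) → ℝ} (hh : 0 < ∑ i, h i)
    (hz : ∀ i, star (z i) * z i = ((κ * h i : ℝ) : ℂ)) (α β : Fin (n + 1) → ℂ) (c d : ℂ) :
    fubiniStudy z (fun i => z i * (α i + c)) (fun i => z i * (β i + d)) =
      ((∑ i, h i * (star (α i) * β i)) / (∑ i, h i : ℝ) -
        (∑ i, h i * star (α i)) * (∑ i, h i * β i) / (∑ i, h i : ℝ) ^ 2 : ℂ).im := by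
  have hN : ∑ i, star (z i) * z i = κ * (∑ i, h i : ℝ) := by
    rw [Finset.sum_congr rfl fun i _ => hz i]
    push_cast
    rw [Finset.mul_sum]
  have hUV : ∑ i, star (z i * (α i + c)) * (z i * (β i + d)) =
      κ * (∑ i, h i * (star (α i) * β i) + (∑ i, h i * star (α i)) * d
        + star c * (∑ i, h i * β i) + star c * d * (∑ i, h i : ℝ)) := by
    push_cast
    simp only [Finset.mul_sum, Finset.sum_mul, ← Finset.sum_add_distrib]
    refine Finset.sum_congr rfl fun i _ => ?_
    have := hz i
    push_cast at this
    rw [star_mul', star_add]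
    linear_combination (star (α i) + star c) * (β i + d) * this
  have hU : ∑ i, star (z i * (α i + c)) * z i =
      κ * (∑ i, h i * star (α i) + star c * (∑ i, h i : ℝ)) := by
    push_cast
    simp only [Finset.mul_sum, ← Finset.sum_add_distrib]
    refine Finset.sum_congr rfl fun i _ => ?_
    have := hz i
    push_cast at this
    rw [star_mul', star_add]
    linear_combination (star (α i) + star c) * this
  have hV : ∑ i, star (z i) * (z i * (β i + d)) =
      κ * (∑ i, h i * β i + d * (∑ i, h i : ℝ)) := by
    push_cast
    simp only [Finset.mul_sum, ← Finset.sum_add_distrib]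
    refine Finset.sum_congr rfl fun i _ => ?_
    have := hz i
    push_cast at this
    linear_combination (β i + d) * this
  have hκ' : (κ : ℂ) ≠ 0 := Complex.ofReal_ne_zero.2 hκ.ne'
  have hh' : ((∑ i, h i : ℝ) : ℂ) ≠ 0 := Complex.ofReal_ne_zero.2 hh.ne'
  unfold fubiniStudy
  rw [hN, hUV, hU, hV]
  congr 1
  field_simp
  ring

theorem sum_div_eq_zero_of_mem_tangentX {n : ℕ} {x u : Coord n} (hr : ∀ i, 0 < x.2.1 i)
    (hu : u ∈ tangentX x) : ∑ i, u.2.1 i / x.2.1 i = 0 := by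
  have h := hu.2.2.2
  rw [fderiv_mu2_apply hr, neg_eq_zero] at h
  exact (mul_eq_zero.1 h).resolve_left (by positivity)

theorem heightSq_mul_logDerivCoord {n : ℕ} {k₁ : ℝ} {x : Coord n} {i : Fin (n + 1)}
    (hh : 0 < heightSq k₁ (x.2.1 i)) (u : Coord n) :
    (heightSq k₁ (x.2.1 i) : ℂ) * logDerivCoord k₁ x u i =
      (-(u.2.1 i / x.2.1 i) / (4 * Real.pi ^ 2) : ℝ) -
        (2 * Real.pi * (heightSq k₁ (x.2.1 i) * u.2.2 i) : ℝ) * Complex.I := by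
  rw [logDerivCoord]
  have h : -(u.2.1 i / x.2.1 i) / (4 * Real.pi ^ 2) = heightSq k₁ (x.2.1 i) *
      (-(u.2.1 i / x.2.1 i) / (4 * Real.pi ^ 2 * heightSq k₁ (x.2.1 i))) := by
    field_simp
  rw [h]
  push_cast
  ring

/-- The real part is a multiple of `∑ u_i / r_i`, which vanishes because `dμ₂(u) = 0`; this is
tangency to the sphere. -/
theorem sum_heightSq_mul_logDerivCoord {n : ℕ} {k₁ : ℝ} {x : Coord n}
    (hr : ∀ i, 0 < x.2.1 i) (hh : ∀ i, 0 < heightSq k₁ (x.2.1 i)) {u : Coord n}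
    (hu : u ∈ tangentX x) :
    ∑ i, (heightSq k₁ (x.2.1 i) : ℂ) * logDerivCoord k₁ x u i =
      (-(2 * Real.pi * ∑ i, heightSq k₁ (x.2.1 i) * u.2.2 i) : ℝ) * Complex.I := by
  simp only [heightSq_mul_logDerivCoord (hh _)]
  rw [Finset.sum_sub_distrib, ← Finset.sum_mul, ← Complex.ofReal_sum, ← Complex.ofReal_sum,
    ← Finset.sum_div, Finset.sum_neg_distrib, sum_div_eq_zero_of_mem_tangentX hr hu,
    ← Finset.mul_sum]
  push_cast
  ring

theorem omega2IsPullback_toricMap {n : ℕ} (hn : 1 ≤ n) {k₁ k₂ : ℝ}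
    (hk : (n : ℝ) + 1 < -k₁ / Real.pi * Real.exp (4 * Real.pi / ((n : ℝ) + 1) * k₂)) :
    Omega2IsPullback (toricMap n hn k₁ k₂) (rho2 n k₁ k₂ ^ 2) := by
  intro x hx F hF u hu v hv
  obtain ⟨c, hc⟩ := hF.fderiv_eq hk hx hu
  obtain ⟨d, hd⟩ := hF.fderiv_eq hk hx hv
  obtain ⟨κ, hκ, hz⟩ := hF.exists_norm_sq_eq hx
  have hr : ∀ i, 0 < x.2.1 i := hx.1
  have hh : ∀ i, 0 < heightSq k₁ (x.2.1 i) := heightSq_pos_of_mem_Xtilde hn hx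
  have hsum : ∑ i, heightSq k₁ (x.2.1 i) = rho2 n k₁ k₂ ^ 2 :=
    (sum_heightSq hx).trans (rho2_sq hk).symm
  have hρ : 0 < rho2 n k₁ k₂ ^ 2 := by
    rw [rho2_sq hk]
    exact rho2_radicand_pos hk
  have hα : ∑ i, (heightSq k₁ (x.2.1 i) : ℂ) * star (logDerivCoord k₁ x u i) =
      ((2 * Real.pi * ∑ i, heightSq k₁ (x.2.1 i) * u.2.2 i : ℝ) : ℂ) * Complex.I := by
    have h := congrArg star (sum_heightSq_mul_logDerivCoord hr hh hu)
    rw [star_sum] at h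
    simp only [star_mul', Complex.star_def, Complex.conj_ofReal, Complex.conj_I] at h
    rw [Complex.star_def, h]
    push_cast
    ring
  -- The height cancels the denominator in the real part of the logarithmic derivative, leaving the
  -- `i`-th summand of `ω̃₂`.
  have him : ∀ i, ((heightSq k₁ (x.2.1 i) : ℂ) *
      (star (logDerivCoord k₁ x u i) * logDerivCoord k₁ x v i)).im =
      1 / (2 * Real.pi) *
        (1 / x.2.1 i * (u.2.1 i * v.2.2 i - u.2.2 i * v.2.1 i)) := by
    intro i
    rw [mul_left_comm, heightSq_mul_logDerivCoord (hh i), logDerivCoord, Complex.star_def]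
    simp only [map_sub, map_mul, Complex.conj_ofReal, Complex.conj_I, Complex.mul_im,
      Complex.sub_re, Complex.sub_im, Complex.mul_re, Complex.neg_re, Complex.neg_im,
      Complex.ofReal_re, Complex.ofReal_im, Complex.I_re, Complex.I_im]
    have h1 := (hr i).ne'
    have h2 := (hh i).ne'
    field_simp
    ring
  rw [funext hc, funext hd, fubiniStudy_mul_add_const hκ (hsum ▸ hρ) hz, hα,
    sum_heightSq_mul_logDerivCoord hr hh hv, hsum, omegaTilde2, Complex.sub_im,
    ← Complex.ofReal_pow, Complex.div_ofReal_im, Complex.div_ofReal_im, Complex.im_sum,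
    Finset.sum_congr rfl fun i _ => him i, ← Finset.mul_sum]
  -- The correction term of the Fubini–Study form is a product of two imaginary numbers, hence real.
  have h0 : ∀ a b : ℝ, ((a : ℂ) * Complex.I * ((b : ℂ) * Complex.I)).im = 0 := fun a b => by
    simp
  rw [h0, zero_div, sub_zero, mul_div_cancel₀ _ hρ.ne']

/-! ### Fibres and leaves -/

/-- The test vectors range over the whole fibred product, so single coordinate directions in `η` and
`r` are allowed and isolate each component of `u`. -/
theorem mem_omega2Null_iff {n : ℕ} {x u : Coord n} (hr : ∀ i, 0 < x.2.1 i) :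
    u ∈ omega2Null x ↔ u ∈ tangentX x ∧ u.2.1 = 0 ∧ u.2.2 = 0 := by
  refine and_congr_right fun _ => ⟨fun h => ?_, fun ⟨h1, h2⟩ w => by simp [omegaTilde2, h1, h2]⟩
  constructor
  · ext i
    have := h (0, 0, Pi.single i 1)
    simpa [omegaTilde2, Pi.single_apply, (hr i).ne', Real.pi_ne_zero] using this
  · ext i
    have := h (0, Pi.single i 1, 0)
    simpa [omegaTilde2, Pi.single_apply, (hr i).ne', Real.pi_ne_zero] using this

/-- In the kernel all logarithmic derivatives equal one constant. Its real part, weighted by the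
heights and summed, is zero by `dμ₂(u) = 0`, so `dr = 0`. Its imaginary part makes the `η`-component
constant in `i`; the components sum to zero, so they vanish. -/
theorem kernel_toricMap {n : ℕ} (hn : 1 ≤ n) {k₁ k₂ : ℝ}
    (hk : (n : ℝ) + 1 < -k₁ / Real.pi * Real.exp (4 * Real.pi / ((n : ℝ) + 1) * k₂))
    {x : Coord n} (hx : coordMap x ∈ Xtilde n k₁ k₂) {F : Coord n → Fin (n + 1) → ℂ}
    (hF : IsLocalLift (toricMap n hn k₁ k₂) x F) {u : Coord n} (hu : u ∈ tangentX x) :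
    (∃ c : ℂ, fderiv ℝ F x u = c • F x) ↔ u ∈ omega2Null x := by
  have hr : ∀ i, 0 < x.2.1 i := hx.1
  have hh : ∀ i, 0 < heightSq k₁ (x.2.1 i) := heightSq_pos_of_mem_Xtilde hn hx
  obtain ⟨d, hd⟩ := hF.fderiv_eq hk hx hu
  obtain ⟨κ, hκ, hz⟩ := hF.exists_norm_sq_eq hx
  have hF0 : ∀ i, F x i ≠ 0 := fun i h0 => by
    have h1 := hz i
    rw [h0, mul_zero, eq_comm, Complex.ofReal_eq_zero] at h1
    exact (mul_pos hκ (hh i)).ne' h1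
  rw [mem_omega2Null_iff hr]
  constructor
  · rintro ⟨c, hc⟩
    have hlog : ∀ i, logDerivCoord k₁ x u i = c - d := fun i => by
      have h1 := hd i
      rw [hc, Pi.smul_apply, smul_eq_mul, mul_comm] at h1
      rw [mul_left_cancel₀ (hF0 i) h1]
      ring
    have hre : ∀ i, -(u.2.1 i / x.2.1 i) / (4 * Real.pi ^ 2) =
        heightSq k₁ (x.2.1 i) * (c - d).re := fun i => by
      have h1 := congrArg Complex.re (heightSq_mul_logDerivCoord (hh i) u)
      rw [hlog, Complex.re_ofReal_mul, Complex.sub_re (Complex.ofReal _), Complex.ofReal_re,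
        Complex.re_ofReal_mul, Complex.I_re, mul_zero, sub_zero] at h1
      exact h1.symm
    have hre0 : (c - d).re = 0 := by
      have h1 : ∑ i, -(u.2.1 i / x.2.1 i) / (4 * Real.pi ^ 2) =
          (∑ i, heightSq k₁ (x.2.1 i)) * (c - d).re := by
        rw [Finset.sum_mul]
        exact Finset.sum_congr rfl fun i _ => hre i
      rw [← Finset.sum_div, Finset.sum_neg_distrib, sum_div_eq_zero_of_mem_tangentX hr hu,
        neg_zero, zero_div, eq_comm] at h1
      exact (mul_eq_zero.1 h1).resolve_left
        (Finset.sum_pos (fun i _ => hh i) Finset.univ_nonempty).ne'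
    have him : ∀ i, -(2 * Real.pi * u.2.2 i) = (c - d).im := fun i => by
      rw [← hlog i, logDerivCoord, Complex.sub_im, Complex.ofReal_im, Complex.im_ofReal_mul,
        Complex.I_im, mul_one, zero_sub]
    refine ⟨hu, funext fun i => ?_, funext fun i => ?_⟩
    · have h1 := hre i
      rw [hre0, mul_zero, div_eq_zero_iff, neg_eq_zero, div_eq_zero_iff] at h1
      exact (h1.resolve_right (by positivity)).resolve_right (hr i).ne'
    · have h1 : ∀ j, u.2.2 j = u.2.2 i := fun j => by
        have h2 := (him j).trans (him i).symm
        have := Real.pi_pos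
        exact mul_left_cancel₀ (by positivity : 2 * Real.pi ≠ 0) (neg_injective h2)
      have h2 := sum_eq_zero_of_mem_range_realHomT_vertexDual hu.2.1
      rw [Finset.sum_congr rfl fun j _ => h1 j, Finset.sum_const, Finset.card_univ,
        Fintype.card_fin, smul_eq_zero] at h2
      exact h2.resolve_left n.succ_ne_zero
  · rintro ⟨-, h1, h2⟩
    refine ⟨d, funext fun i => ?_⟩
    rw [hd i, logDerivCoord, h1, h2]
    simp [mul_comm]

theorem toricMap_fibre {n : ℕ} (hn : 1 ≤ n) {k₁ k₂ : ℝ} (p : XSpace n k₁ k₂) :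
    toricMap n hn k₁ k₂ ⁻¹' {toricMap n hn k₁ k₂ p} = leafThrough omega2Null p := by
  ext q
  constructor
  · intro h
    induction p using Quotient.inductionOn with
    | _ p =>
    induction q using Quotient.inductionOn with
    | _ q =>
    obtain ⟨hr, hη⟩ := (toricMap_eq_iff hn p q).1 (Set.mem_singleton_iff.1 h).symm
    obtain ⟨Y, hY⟩ := exists_realHomT_coe p.2.2.1
    obtain ⟨Y', hY'⟩ := exists_realHomT_coe q.2.2.1
    obtain ⟨E, hE⟩ := Torus.exists_coe p.1.2.2
    -- Only `θ` moves, along the segment from the lift of `p` to that of `q`, while `r` and `η` stay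
    -- those of `p`.
    let γ : ℝ → Coord n := fun t => (realHomT (vertexDelta n) Y +
      t • realHomT (vertexDelta n) (Y' - Y), p.1.2.1, E)
    have hγ : ∀ t, HasDerivAt γ (realHomT (vertexDelta n) (Y' - Y), 0, 0) t := fun t => by
      refine HasDerivAt.prodMk ?_ (hasDerivAt_const _ _)
      simpa using ((hasDerivAt_id t).smul_const (realHomT (vertexDelta n) (Y' - Y))).const_add
        (realHomT (vertexDelta n) Y)
    have hX : ∀ t, coordMap (γ t) ∈ Xtilde n k₁ k₂ := fun t => by
      refine ⟨p.2.1, coe_mem_range_torusHomT (w := vertexDelta n) ?_, ?_, p.2.2.2.2⟩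
      · exact ⟨Y + t • (Y' - Y), by simp [γ]⟩
      · simp only [coordMap, γ]
        rw [← hE]
        exact p.2.2.2.1
    refine ⟨γ, ?_, fun t _ => ⟨hX t, ?_⟩, ⟨hX 0, ?_⟩, ⟨hX 1, ?_⟩⟩
    · exact (contDiff_const.add (contDiff_id.smul contDiff_const)).prodMk contDiff_const
    · rw [(hγ t).deriv, mem_omega2Null_iff (hX t).1]
      exact ⟨⟨⟨_, rfl⟩, zero_mem _, by simp, by simp⟩, rfl, rfl⟩
    · refine congrArg (Quotient.mk _) (Subtype.ext (Prod.ext ?_ (Prod.ext rfl hE.symm)))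
      simp only [coordMap, γ, zero_smul, add_zero]
      exact hY.symm
    -- The endpoint still carries the `η` of `p`; the discrepancy with `q` lies in `D_{Δ*}` and
    -- disappears in the quotient.
    · refine Quotient.sound (s := Xsetoid n k₁ k₂) ⟨?_, hr, ?_⟩
      · have : q.1.1 - (coordMap (γ 1)).1 = 0 := by
          simp only [coordMap, γ, one_smul, ← map_add, add_sub_cancel]
          rw [hY', sub_self]
        rw [this]
        exact zero_mem _
      · simp only [coordMap, γ]
        rw [← hE]
        exact hη
  · rintro ⟨γ, hγ, hγX, ⟨h0, rfl⟩, ⟨h1, rfl⟩⟩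
    have hd : ∀ t, HasDerivAt γ (deriv γ t) t := fun t =>
      (hγ.differentiable (by simp) t).hasDerivAt
    -- Null vectors have no `r`- or `η`-component, so these coordinates are constant along the
    -- curve. Tangency is known only on `[0, 1]`, hence the one-sided criterion.
    have hconst : (γ 1).2 = (γ 0).2 := by
      refine constant_of_has_deriv_right_zero (f := fun t => (γ t).2) (a := 0) (b := 1)
        (continuous_snd.comp hγ.continuous).continuousOn (fun t ht => ?_) 1 (by simp)
      have h2 := hγX t (Set.Ico_subset_Icc_self ht)
      have h3 := (mem_omega2Null_iff h2.1.1).1 h2.2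
      have h4 : HasDerivAt (fun t => (γ t).2) (deriv γ t).2 t :=
        (hasFDerivAt_snd (𝕜 := ℝ) (p := γ t)).comp_hasDerivAt t (hd t)
      rw [show (deriv γ t).2 = 0 from Prod.ext h3.2.1 h3.2.2] at h4
      exact h4.hasDerivWithinAt
    refine Set.mem_singleton_iff.2 (Eq.symm ?_)
    refine (toricMap_eq_iff hn ⟨_, h0⟩ ⟨_, h1⟩).2 ⟨(congrArg Prod.fst hconst :), ?_⟩
    simp only [coordMap, hconst, sub_self]
    exact zero_mem _

theorem mainTheorem3 (n : ℕ) (hn : 1 ≤ n) (k₁ k₂ : ℝ)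
    (hk : (n : ℝ) + 1 < -k₁ / Real.pi * Real.exp (4 * Real.pi / ((n : ℝ) + 1) * k₂)) :
    ∃ π₂ : XSpace n k₁ k₂ → DualToric n,
      IsSmoothToH π₂ ∧
      FibresAreLeaves π₂ omega2Null ∧
      (∀ (t : Torus n × Torus n) (p : XSpace n k₁ k₂), π₂ (t +ᵥ p) = (-t.2) +ᵥ π₂ p) ∧
      0 < rho2 n k₁ k₂ ∧ Omega2IsPullback π₂ (rho2 n k₁ k₂ ^ 2) ∧
      Set.range π₂ = {h : DualToric n | ∃ (z : Fin (n + 1) → ℂ) (hz : z ≠ 0), h = DualToric.mk z hz ∧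
        ∑ i, ‖z i‖ ^ 2 = rho2 n k₁ k₂ ^ 2 ∧
        ∑ i, Real.exp (-4 * Real.pi ^ 2 * ‖z i‖ ^ 2) = 1} :=
  ⟨toricMap n hn k₁ k₂, fun _ hx => ⟨_, isLocalLift_toricMap hn hx⟩,
    ⟨toricMap_fibre hn, fun _ hx _ hF _ hu => kernel_toricMap hn hk hx hF hu⟩,
    toricMap_vadd hn, Real.sqrt_pos.2 (rho2_radicand_pos hk), omega2IsPullback_toricMap hn hk,
    range_toricMap hn hk⟩
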